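/- Let $a<b$ be real numbers. For every real $r\ge 1$ there is a function $f\colon[a,b]\to\mathbb R$ that is HK$_r$-integrable but is P$_s$-integrable for no real $s\ge 1$. The notions are as follows; throughout, elements of $L^r[a,b]$ are functions with definite values at every point. **HK$_r$-integrability.** $f$ is HK$_r$-integrable ($L^r$ Henstock–Kurzweil integrable) on $[a,b]$ if there is $F\in L^r[a,b]$ such that for every $\varepsilon>0$ there is $\delta\colon[a,b]\to(0,\infty)$ such that $$\sum_{i=1}^n\left(\frac1{d_i-c_i}\int_{c_i}^{d_i}\bigl|F(y)-F(x_i)-f(x_i)(y-x_i)\bigr|^r\,dy\right)^{1/r}<\varepsilon$$ for every finite collection of nonoverlapping intervals $[c_i,d_i]\subset[a,b]$ with tags $x_i\in[c_i,d_i]$ satisfying $[c_i,d_i]\subset(x_i-\delta(x_i),x_i+\delta(x_i))$. **$L^s$-continuity.** $F\in L^s[a,b]$ is $L^s$-continuous at $x\in[a,b]$ if $\left(\frac1h\int_{[x-h,x+h]\cap[a,b]}|F(y)-F(x)|^s\,dy\right)^{1/s}\to0$ as $h\to0^+$. **$L^s$-derivates.** The upper-right $L^s$-derivate of $F\in L^s[a,b]$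 at $x\in[a,b)$ is the infimum in $[-\infty,+\infty]$ of all $\alpha\in\mathbb R$ such that $\left(\frac1h\int_0^h[F(x+t)-F(x)-\alpha t]_+^s\,dt\right)^{1/s}=o(h)$ as $h\to0^+$, where $[w]_+=\max\{w,0\}$; it is $+\infty$ if there is no such $\alpha$. The upper-left $L^s$-derivate at $x\in(a,b]$ is defined in the same way with $[F(x)-F(x-t)-\alpha t]_+$. The upper $L^s$-derivate $\overline D_sF(x)$ is the larger of these two if $a<x<b$, the upper-right one if $x=a$, and the upper-left one if $x=b$. **P$_s$-integrability.** $m\in L^s[a,b]$ is an $L^s$-minor function of $f$ if $m(a)=0$, $m$ is $L^s$-continuous at every point of $[a,b]$, $\overline D_sm(x)\le f(x)$ for almost every $x\in[a,b]$, and $\overline D_sm(x)<+\infty$ for all but countably many $x\in[a,b]$. $M$ is an $L^s$-major function of $f$ if $-M$ is an $L^s$-minor function of $-f$. $f$ is P$_s$-integrable on $[a,b]$ if for every $\varepsilon>0$ there are an $L^s$-major function $M$ and an $L^s$-minor function $m$ of $f$ with $M(b)-m(b)<\varepsilon$. -/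

import Mathlib

open MeasureTheory Set Filter Topology Asymptotics

noncomputable section

/-- `F ∈ L^r[a,b]`. `F` is an honest function, since its pointwise values matter below; only its
values on `[a,b]` are used. -/
def MemLr (r a b : ℝ) (F : ℝ → ℝ) : Prop :=
  MemLp F (ENNReal.ofReal r) (volume.restrict (Icc a b))

/-- The `L^r` Henstock--Kurzweil integral (Musial--Sagher): there is `F ∈ L^r[a,b]` such that for
every `ε > 0` there is a gauge `δ` on `[a,b]` such that every finite family of nonoverlapping
`δ`-fine tagged intervals `(x_i, [c_i,d_i])` in `[a,b]` satisfies
`∑ (1/(d_i-c_i) ∫_{c_i}^{d_i} |F(y)-F(x_i)-f(x_i)(y-x_i)|^r dy)^{1/r} < ε`. -/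
def HKIntegrable (r a b : ℝ) (f : ℝ → ℝ) : Prop :=
  ∃ F : ℝ → ℝ, MemLr r a b F ∧
    ∀ ε : ℝ, 0 < ε → ∃ δ : ℝ → ℝ, (∀ x ∈ Icc a b, 0 < δ x) ∧
      ∀ (n : ℕ) (c d x : Fin n → ℝ),
        (∀ i, a ≤ c i ∧ c i < d i ∧ d i ≤ b) →
        (∀ i, x i ∈ Icc (c i) (d i)) →
        (∀ i, Icc (c i) (d i) ⊆ Ioo (x i - δ (x i)) (x i + δ (x i))) →
        (∀ i j, i ≠ j → Disjoint (Ioo (c i) (d i)) (Ioo (c j) (d j))) →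
        ∑ i, ((1 / (d i - c i)) *
          ∫ y in (c i)..(d i), |F y - F (x i) - f (x i) * (y - x i)| ^ r) ^ (1 / r) < ε

/-- `L^r`-continuity at a point `x` of `[a,b]`; near an endpoint only the part of `[x-h,x+h]`
inside `[a,b]` counts. -/
def LrContinuousAt (r a b : ℝ) (F : ℝ → ℝ) (x : ℝ) : Prop :=
  Tendsto (fun h : ℝ =>
      ((1 / h) * ∫ y in (max a (x - h))..(min b (x + h)), |F y - F x| ^ r) ^ (1 / r))
    (𝓝[>] 0) (𝓝 0)

/-- The upper-right `L^r`-derivate: the infimum of the real `α` with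
`(1/h ∫_0^h [F(x+t)-F(x)-αt]_+^r dt)^{1/r} = o(h)` as `h → 0+` (it is `+∞` if there are none). -/
def upperRightDerivate (r : ℝ) (F : ℝ → ℝ) (x : ℝ) : EReal :=
  sInf ((fun α : ℝ => (α : EReal)) '' {α : ℝ |
    (fun h : ℝ => ((1 / h) * ∫ t in (0 : ℝ)..h, (max (F (x + t) - F x - α * t) 0) ^ r) ^ (1 / r))
      =o[𝓝[>] 0] (fun h : ℝ => h)})

/-- The upper-left `L^r`-derivate, with the difference `F(x)-F(x-t)-αt`. -/
def upperLeftDerivate (r : ℝ) (F : ℝ → ℝ) (x : ℝ) : EReal :=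
  sInf ((fun α : ℝ => (α : EReal)) '' {α : ℝ |
    (fun h : ℝ => ((1 / h) * ∫ t in (0 : ℝ)..h, (max (F x - F (x - t) - α * t) 0) ^ r) ^ (1 / r))
      =o[𝓝[>] 0] (fun h : ℝ => h)})

/-- The bilateral upper `L^r`-derivate at a point `x` of `[a,b]`: the larger of the two unilateral
ones, with only the available one counted at an endpoint. -/
def upperDerivate (r a b : ℝ) (F : ℝ → ℝ) (x : ℝ) : EReal :=
  max (if x < b then upperRightDerivate r F x else ⊥)
    (if a < x then upperLeftDerivate r F x else ⊥)

/-- `m` is an `L^r`-minor function of `f` on `[a,b]`. -/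
structure IsLrMinor (r a b : ℝ) (f m : ℝ → ℝ) : Prop where
  memLr : MemLr r a b m
  map_left : m a = 0
  continuousAt : ∀ x ∈ Icc a b, LrContinuousAt r a b m x
  derivate_le : ∀ᵐ x ∂(volume.restrict (Icc a b)), upperDerivate r a b m x ≤ (f x : EReal)
  derivate_lt_top : {x ∈ Icc a b | ¬ upperDerivate r a b m x < ⊤}.Countable

/-- `M` is an `L^r`-major function of `f` if `-M` is an `L^r`-minor function of `-f`. -/
def IsLrMajor (r a b : ℝ) (f M : ℝ → ℝ) : Prop :=
  IsLrMinor r a b (fun x => -f x) (fun x => -M x)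

/-- `P_r`-integrability on `[a,b]`. -/
def PerronIntegrable (r a b : ℝ) (f : ℝ → ℝ) : Prop :=
  ∀ ε : ℝ, 0 < ε → ∃ M m : ℝ → ℝ,
    IsLrMajor r a b f M ∧ IsLrMinor r a b f m ∧ M b - m b < ε

end

/-! Choose countably many disjoint gaps in `(a, b)` with dense union whose widths `w` satisfy `∑ w ^
(1/r) < ∞`, and put in the middle of each a smooth bump of height 1 supported within a radius
proportional to `w ^ 2`. Let `F` be the sum of the bumps and `f = deriv F`; both vanish on the
residue, the complement of the open gaps in `[a, b]`.

`f` is HK_r-integrable with primitive `F` (`hkIntegrable_deriv_bumpSum`). Tags inside gaps are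
handled by differentiability. For a tag in the residue the term is just the `L^r` mean of `F` over
`[c, d]`. Every bump met there belongs to a gap at least a third of which lies in `[c, d]`, so `w ≤
3 (d - c)`, and the quadratic radius absorbs the division by `d - c`: the mean is at most a constant
times the sum of `w ^ (1/r)` over these gaps. Each gap is counted at most three times, and a small
gauge removes any finite set of gaps.

`f` is not P_s-integrable (`not_perronIntegrable_deriv_bumpSum`). Let `m` be a minor function of `f`
and `M` the negative of a major function. A monotonicity theorem for approximate derivates,
`monotone_of_approx`, shows that `m + M` is nonincreasing on `[a, b]` and `F + M` is nonincreasing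
in each gap. Finiteness of the upper `L^s`-derivates, through Chebyshev and Baire, gives on a dense
part of a portion of the residue a uniform bound: at scale `h` the increments of `m` and `M` exceed
a fixed slope by 1/4 only on a set of measure `η h ^ 2`. Next to a small gap this is less than the
width of the plateau of the bump. As `M` must fall by 1 while `F` rises by 1, `m + M` falls by 1/4
across each of infinitely many gaps, which a nonincreasing function on `[a, b]` cannot do
(`exists_drop`). -/

/-! ### Approximate one-sided estimates -/

/-- For every `η > 0` and all small `h > 0`, the increment `D` satisfies `D t ≤ β t + η h` for
`t ∈ (0, h)` outside a set of measure at most `η h`. -/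
def ApproxLE (D : ℝ → ℝ) (β : ℝ) : Prop :=
  ∀ η : ℝ, 0 < η → ∀ᶠ h in 𝓝[>] (0 : ℝ),
    volume {t | t ∈ Ioo 0 h ∧ β * t + η * h < D t} ≤ ENNReal.ofReal (η * h)

/-- For every `η > 0` and all small `h > 0`, the increment `D` satisfies `|D t| ≤ η` for
`t ∈ (0, h)` outside a set of measure at most `η h`. -/
def ApproxSmall (D : ℝ → ℝ) : Prop :=
  ∀ η : ℝ, 0 < η → ∀ᶠ h in 𝓝[>] (0 : ℝ),
    volume {t | t ∈ Ioo 0 h ∧ η < |D t|} ≤ ENNReal.ofReal (η * h)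

/-- Using the definition at `min η κ` separates the tolerance in height from the tolerance in
measure. -/
theorem ApproxLE.eventually_volume_le {D : ℝ → ℝ} {β : ℝ} (hD : ApproxLE D β) {η κ : ℝ}
    (hη : 0 < η) (hκ : 0 < κ) : ∀ᶠ h in 𝓝[>] (0 : ℝ),
      volume {t | t ∈ Ioo 0 h ∧ β * t + η * h < D t} ≤ ENNReal.ofReal (κ * h) := by
  filter_upwards [hD (min η κ) (lt_min hη hκ), self_mem_nhdsWithin] with h hh h0
  refine (measure_mono ?_).trans (hh.trans
    (ENNReal.ofReal_le_ofReal (mul_le_mul_of_nonneg_right (min_le_right _ _) (le_of_lt h0))))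
  rintro t ⟨ht, hlt⟩
  refine ⟨ht, lt_of_le_of_lt ?_ hlt⟩
  have := mul_le_mul_of_nonneg_right (min_le_left η κ) (le_of_lt h0)
  linarith

theorem ApproxSmall.eventually_volume_le {D : ℝ → ℝ} (hD : ApproxSmall D) {η κ : ℝ}
    (hη : 0 < η) (hκ : 0 < κ) : ∀ᶠ h in 𝓝[>] (0 : ℝ),
      volume {t | t ∈ Ioo 0 h ∧ η < |D t|} ≤ ENNReal.ofReal (κ * h) := by
  filter_upwards [hD (min η κ) (lt_min hη hκ), self_mem_nhdsWithin] with h hh h0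
  refine (measure_mono ?_).trans (hh.trans
    (ENNReal.ofReal_le_ofReal (mul_le_mul_of_nonneg_right (min_le_right _ _) (le_of_lt h0))))
  rintro t ⟨ht, hlt⟩
  exact ⟨ht, (min_le_left _ _).trans_lt hlt⟩

theorem volume_preimage_sub_right (x : ℝ) (A : Set ℝ) :
    volume ((fun y => y - x) ⁻¹' A) = volume A := by
  simp [sub_eq_add_neg]

theorem volume_preimage_sub_left (x : ℝ) (A : Set ℝ) :
    volume ((fun y => x - y) ⁻¹' A) = volume A :=
  (Measure.measurePreserving_sub_left volume x).measure_preimage_equiv (f := MeasurableEquiv.subLeft x) A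

theorem exists_mem_Ioo_notMem_of_volume_le {p q α β : ℝ} {A B : Set ℝ} (hα : 0 ≤ α) (hβ : 0 ≤ β)
    (hA : volume A ≤ ENNReal.ofReal α) (hB : volume B ≤ ENNReal.ofReal β) (h : α + β < q - p) :
    ∃ y ∈ Ioo p q, y ∉ A ∧ y ∉ B := by
  by_contra! hcon
  have hsub : Ioo p q ⊆ A ∪ B := fun y hy => by
    by_cases hyA : y ∈ A
    · exact Or.inl hyA
    · exact Or.inr (hcon y hy hyA)
  have := (measure_mono hsub).trans ((measure_union_le A B).trans (add_le_add hA hB))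
  rw [Real.volume_Ioo, ← ENNReal.ofReal_add hα hβ, ENNReal.ofReal_le_ofReal_iff (by positivity)]
    at this
  linarith

theorem ApproxSmall.exists_abs_le {D : ℝ → ℝ} (hD : ApproxSmall D) {η τ : ℝ} (hη : 0 < η)
    (hτ : 0 < τ) : ∃ t ∈ Ioo 0 τ, |D t| ≤ η := by
  obtain ⟨h, hh, hlt⟩ := ((hD.eventually_volume_le hη (κ := 1 / 16) (by norm_num)).and (Ioo_mem_nhdsGT hτ)).exists
  obtain ⟨t, ht, hA, -⟩ := exists_mem_Ioo_notMem_of_volume_le (p := 0) (q := h) (B := ∅) (β := 0)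
    (by linarith [hlt.1]) le_rfl hh (by simp) (by linarith [hlt.1])
  refine ⟨t, ⟨ht.1, ht.2.trans hlt.2⟩, ?_⟩
  by_contra! hcon
  exact hA ⟨ht, hcon⟩

/-! ### Baire category and a monotonicity theorem for approximate derivates -/

/-- Baire's theorem in the complete space `H`, covered by the closures of the `E n` and the single
points of `C`. The single points have no interior because `H` has no isolated points. -/
theorem exists_portion_subset_closure {H : Set ℝ} (hH : IsClosed H) (hne : H.Nonempty)
    (hperf : ∀ x ∈ H, ∀ ε : ℝ, 0 < ε → ∃ y ∈ H, y ≠ x ∧ |y - x| < ε) {C : Set ℝ}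
    (hC : C.Countable) {E : ℕ → Set ℝ} (hcov : H ⊆ C ∪ ⋃ n, E n) :
    ∃ n, ∃ x ∈ H, ∃ ε : ℝ, 0 < ε ∧ ∀ y ∈ H, |y - x| < ε → y ∈ closure (E n) := by
  have := hH.completeSpace_coe
  have := hne.to_subtype
  have := hC.to_subtype
  let f : C ⊕ ℕ → Set H := fun i => match i with
    | .inl c => {y | (y : ℝ) = c}
    | .inr n => Subtype.val ⁻¹' closure (E n)
  have hf : ∀ i, IsClosed (f i) := by
    rintro (c | n)
    · exact isClosed_eq continuous_subtype_val continuous_const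
    · exact isClosed_closure.preimage continuous_subtype_val
  have hU : ⋃ i, f i = univ := by
    refine eq_univ_of_forall fun y => mem_iUnion.2 ?_
    rcases hcov y.2 with h | h
    · exact ⟨.inl ⟨y, h⟩, rfl⟩
    · obtain ⟨n, hn⟩ := mem_iUnion.1 h
      exact ⟨.inr n, subset_closure hn⟩
  obtain ⟨i, x, hx⟩ := nonempty_interior_of_iUnion_of_closed hf hU
  obtain ⟨ε, hε, hball⟩ := Metric.mem_nhds_iff.1 (mem_interior_iff_mem_nhds.1 hx)
  have hball' : ∀ y (hy : y ∈ H), |y - x| < ε → (⟨y, hy⟩ : H) ∈ f i := fun y hy h =>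
    hball (by simpa [Metric.mem_ball, Subtype.dist_eq, Real.dist_eq] using h)
  rcases i with c | n
  · obtain ⟨y, hy, hne, hlt⟩ := hperf x x.2 ε hε
    have h1 : y = c := hball' y hy hlt
    have h2 : (x : ℝ) = c := hball' x x.2 (by simpa using hε)
    exact absurd (h1.trans h2.symm) hne
  · exact ⟨n, x, x.2, ε, hε, fun y hy h => hball' y hy h⟩

/-- The points near which `R` is nondecreasing. -/
def locallyMonotoneSet (R : ℝ → ℝ) : Set ℝ :=
  {x | ∃ ε : ℝ, 0 < ε ∧ MonotoneOn R (Ioo (x - ε) (x + ε))}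

theorem isOpen_locallyMonotoneSet (R : ℝ → ℝ) : IsOpen (locallyMonotoneSet R) := by
  refine Metric.isOpen_iff.2 ?_
  rintro x ⟨ε, hε, hm⟩
  refine ⟨ε / 2, by positivity, fun y hy => ⟨ε / 2, by positivity, hm.mono ?_⟩⟩
  rw [Metric.mem_ball, Real.dist_eq, abs_lt] at hy
  exact Ioo_subset_Ioo (by linarith) (by linarith)

theorem le_of_Icc_subset_locallyMonotoneSet {R : ℝ → ℝ} {x y : ℝ} (hxy : x ≤ y)
    (h : Icc x y ⊆ locallyMonotoneSet R) : R x ≤ R y := by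
  choose ε hε hm using fun z (hz : z ∈ Icc x y) => h hz
  let c : Icc x y → Set (Icc x y) := fun i => Subtype.val ⁻¹' Ioo ((i : ℝ) - ε i i.2) (i + ε i i.2)
  obtain ⟨t, h0, hmono, ⟨m, hm'⟩, hsub⟩ := exists_monotone_Icc_subset_open_cover_Icc hxy (c := c)
    (fun i => isOpen_Ioo.preimage continuous_subtype_val)
    (fun i _ => mem_iUnion.2 ⟨i, by have := hε i i.2; constructor <;> linarith⟩)
  have key : ∀ n, R x ≤ R (t n) := by
    intro n
    induction n with
    | zero => rw [h0]
    | succ n ih =>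
      obtain ⟨i, hi⟩ := hsub n
      have hle := hmono (Nat.le_succ n)
      exact ih.trans (hm i i.2 (hi (left_mem_Icc.2 hle)) (hi (right_mem_Icc.2 hle)) hle)
  have := key m
  rwa [hm' m le_rfl] at this

/-- Approximate continuity provides points just inside the interval at which `R` nearly takes its
end values. -/
theorem le_of_Ioo_subset_locallyMonotoneSet {R : ℝ → ℝ}
    (hcr : ∀ x, ApproxSmall fun t => R (x + t) - R x)
    (hcl : ∀ x, ApproxSmall fun t => R (x - t) - R x) {x y : ℝ} (hxy : x ≤ y)
    (h : Ioo x y ⊆ locallyMonotoneSet R) : R x ≤ R y := by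
  rcases hxy.eq_or_lt with rfl | hlt
  · exact le_rfl
  refine le_of_forall_pos_le_add fun η hη => ?_
  obtain ⟨s, hs, hs'⟩ := (hcr x).exists_abs_le (half_pos hη) (half_pos (sub_pos.2 hlt))
  obtain ⟨t, ht, ht'⟩ := (hcl y).exists_abs_le (half_pos hη) (half_pos (sub_pos.2 hlt))
  have := le_of_Icc_subset_locallyMonotoneSet (R := R) (x := x + s) (y := y - t)
    (by linarith [hs.2, ht.2]) ((Icc_subset_Ioo (by linarith [hs.1]) (by linarith [ht.1])).trans h)
  linarith [(abs_le.1 hs').1, (abs_le.1 ht').2]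

/-- An isolated point of the complement could be glued over: monotonicity on its two sides extends
to the point itself. Hence the complement is perfect, as Baire's theorem requires here. -/
theorem exists_abs_sub_lt_notMem_locallyMonotoneSet {R : ℝ → ℝ}
    (hcr : ∀ x, ApproxSmall fun t => R (x + t) - R x)
    (hcl : ∀ x, ApproxSmall fun t => R (x - t) - R x) {x : ℝ} (hx : x ∉ locallyMonotoneSet R)
    {ε : ℝ} (hε : 0 < ε) : ∃ y, y ∉ locallyMonotoneSet R ∧ y ≠ x ∧ |y - x| < ε := by
  by_contra! hcon
  refine hx ⟨ε, hε, fun u hu v hv huv => ?_⟩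
  have hG : ∀ z ∈ Ioo (x - ε) (x + ε), z ≠ x → z ∈ locallyMonotoneSet R := fun z hz hzx => by
    by_contra hz'
    have := hcon z hz' hzx
    rw [le_abs] at this
    rcases this with h | h <;> linarith [hz.1, hz.2]
  by_cases hmid : x ∈ Ioo u v
  · refine (le_of_Ioo_subset_locallyMonotoneSet hcr hcl hmid.1.le fun z hz => hG z ?_ hz.2.ne).trans
      (le_of_Ioo_subset_locallyMonotoneSet hcr hcl hmid.2.le fun z hz => hG z ?_ hz.1.ne')
    · exact ⟨hu.1.trans hz.1, by linarith [hz.2]⟩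
    · exact ⟨by linarith [hz.1], hz.2.trans hv.2⟩
  · refine le_of_Ioo_subset_locallyMonotoneSet hcr hcl huv fun z hz => hG z ?_ ?_
    · exact ⟨hu.1.trans hz.1, hz.2.trans hv.2⟩
    · rintro rfl
      exact hmid hz

/-- The points at which most increments of `R` at every scale `h < 1/(n+1)` are bounded below by
`-n h`. -/
def uniformLowerSet (R : ℝ → ℝ) (n : ℕ) : Set ℝ :=
  {x | ∀ h : ℝ, 0 < h → h < 1 / (n + 1) →
    volume {t | t ∈ Ioo 0 h ∧ n * h < R x - R (x + t)} ≤ ENNReal.ofReal (1 / 16 * h) ∧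
    volume {t | t ∈ Ioo 0 h ∧ n * h < R (x - t) - R x} ≤ ENNReal.ofReal (1 / 16 * h)}

theorem ApproxLE.eventually_of_le {D : ℝ → ℝ} {β : ℝ} (hD : ApproxLE D β) :
    ∃ N : ℕ, ∀ n : ℕ, N ≤ n → ∀ h : ℝ, 0 < h → h < 1 / (n + 1) →
      volume {t | t ∈ Ioo 0 h ∧ n * h < D t} ≤ ENNReal.ofReal (1 / 16 * h) := by
  obtain ⟨τ, hτ, hsub⟩ := mem_nhdsGT_iff_exists_Ioo_subset.1 
    (hD.eventually_volume_le one_pos (κ := 1 / 16) (by norm_num))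
  obtain ⟨N₁, hN₁⟩ := exists_nat_gt (|β| + 1)
  obtain ⟨N₂, hN₂⟩ := exists_nat_one_div_lt (mem_Ioi.1 hτ)
  refine ⟨max N₁ N₂, fun n hn h h0 h1 => (measure_mono ?_).trans (hsub ⟨h0, ?_⟩)⟩
  · rintro t ⟨ht, hlt⟩
    refine ⟨ht, lt_of_le_of_lt ?_ hlt⟩
    have h1 : (N₁ : ℝ) ≤ n := by exact_mod_cast (le_max_left _ _).trans hn
    have h2 : β * t ≤ |β| * h := (le_abs_self _).trans
      (by rw [abs_mul, abs_of_pos ht.1]; exact mul_le_mul_of_nonneg_left ht.2.le (abs_nonneg _))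
    nlinarith
  · have h2 : (N₂ : ℝ) ≤ n := by exact_mod_cast (le_max_right _ _).trans hn
    exact h1.trans (lt_of_le_of_lt (one_div_le_one_div_of_le (by positivity) (by linarith)) hN₂)

theorem mem_iUnion_uniformLowerSet {R : ℝ → ℝ} {x : ℝ}
    (hr : ∃ β, ApproxLE (fun t => R x - R (x + t)) β)
    (hl : ∃ β, ApproxLE (fun t => R (x - t) - R x) β) : x ∈ ⋃ n, uniformLowerSet R n := by
  obtain ⟨β, hβ⟩ := hr
  obtain ⟨γ, hγ⟩ := hl
  obtain ⟨N₁, h₁⟩ := hβ.eventually_of_le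
  obtain ⟨N₂, h₂⟩ := hγ.eventually_of_le
  exact mem_iUnion.2 ⟨max N₁ N₂, fun h h0 hlt =>
    ⟨h₁ _ (le_max_left _ _) h h0 hlt, h₂ _ (le_max_right _ _) h h0 hlt⟩⟩

/-- The bad sets of `x` and `y` each fill at most 1/16 of the interval between them, so some `z` is
good for both and links the two values. -/
theorem le_add_of_mem_uniformLowerSet {R : ℝ → ℝ} {n : ℕ} {x y : ℝ}
    (hx : x ∈ uniformLowerSet R n) (hy : y ∈ uniformLowerSet R n) (hxy : x < y)
    (hlt : y - x < 1 / (n + 1)) : R x ≤ R y + 2 * n * (y - x) := by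
  have h0 : 0 < y - x := sub_pos.2 hxy
  obtain ⟨z, hz, hA, hB⟩ := exists_mem_Ioo_notMem_of_volume_le (p := x) (q := y) (by positivity)
    (by positivity) ((volume_preimage_sub_right x _).trans_le (hx _ h0 hlt).1)
    ((volume_preimage_sub_left y _).trans_le (hy _ h0 hlt).2) (by linarith)
  simp only [mem_preimage, mem_ofPred_eq, not_and, not_lt, add_sub_cancel, sub_sub_cancel] at hA hB
  have h1 := hA ⟨by linarith [hz.1], by linarith [hz.2]⟩
  have h2 := hB ⟨by linarith [hz.2], by linarith [hz.1]⟩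
  linarith

/-- The point `x` need not belong to the set, so bounds valid on the set pass to its closure. A
point `z` to the left of both `x` and `e`, good for both, bounds `R e` from below; one to the right
bounds it from above. -/
theorem eventually_abs_sub_le_of_mem_uniformLowerSet {R : ℝ → ℝ} {x : ℝ}
    (hcr : ApproxSmall fun t => R (x + t) - R x) (hcl : ApproxSmall fun t => R (x - t) - R x)
    (n : ℕ) {η : ℝ} (hη : 0 < η) :
    ∃ τ : ℝ, 0 < τ ∧ ∀ e ∈ uniformLowerSet R n, |e - x| < τ → |R e - R x| ≤ η := by
  have hτ : 0 < min (1 / ((n : ℝ) + 1)) (η / (2 * (n + 1))) := by positivity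
  obtain ⟨h, ⟨h1, h2⟩, hpos, hlt⟩ :=
    (((hcr.eventually_volume_le (half_pos hη) (κ := 1 / 16) (by norm_num)).and
      (hcl.eventually_volume_le (half_pos hη) (κ := 1 / 16) (by norm_num))).and
      (Ioo_mem_nhdsGT hτ)).exists
  have hn : n * h ≤ η / 2 := by
    have := hlt.trans_le (min_le_right _ _)
    rw [lt_div_iff₀ (by positivity)] at this
    nlinarith
  refine ⟨h / 4, by positivity, fun e he hex => ?_⟩
  rw [abs_lt] at hex
  have hE := he h hpos (hlt.trans_le (min_le_left _ _))
  rw [abs_le]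
  constructor
  · obtain ⟨z, hz, hA, hB⟩ := exists_mem_Ioo_notMem_of_volume_le (p := max x e - 3 * h / 4)
      (q := min x e) (by positivity) (by positivity)
      ((volume_preimage_sub_left x _).trans_le h2)
      ((volume_preimage_sub_left e _).trans_le hE.2) (by
        rcases le_total x e with h | h <;> simp [h] <;> linarith)
    simp only [mem_preimage, mem_ofPred_eq, not_and, not_lt, sub_sub_cancel] at hA hB
    have e1 := lt_min_iff.1 hz.2
    have e2 := hz.1
    have e3 := le_max_left x e
    have e4 := le_max_right x e
    have h3 := (abs_le.1 (hA ⟨by linarith, by linarith⟩)).1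
    have h4 := hB ⟨by linarith, by linarith⟩
    linarith
  · obtain ⟨z, hz, hA, hB⟩ := exists_mem_Ioo_notMem_of_volume_le (p := max x e)
      (q := min x e + 3 * h / 4) (by positivity) (by positivity)
      ((volume_preimage_sub_right x _).trans_le h1)
      ((volume_preimage_sub_right e _).trans_le hE.1) (by
        rcases le_total x e with h | h <;> simp [h] <;> linarith)
    simp only [mem_preimage, mem_ofPred_eq, not_and, not_lt, add_sub_cancel] at hA hB
    have e1 := max_lt_iff.1 hz.1
    have e2 := hz.2
    have e3 := min_le_left x e
    have e4 := min_le_right x e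
    have h3 := (abs_le.1 (hA ⟨by linarith, by linarith⟩)).2
    have h4 := hB ⟨by linarith, by linarith⟩
    linarith

theorem ApproxLE.deriv_nonneg {R : ℝ → ℝ} {x R' : ℝ} (hd : HasDerivAt R R' x)
    (ha : ∀ β > 0, ApproxLE (fun t => R x - R (x + t)) β) : 0 ≤ R' := by
  by_contra! hneg
  have h1 : ∀ᶠ t in 𝓝[>] (0 : ℝ), R (x + t) - R x ≤ R' / 2 * t := by
    have := hd.tendsto_slope_zero_right
    filter_upwards [this.eventually_lt_const (show R' < R' / 2 by linarith), self_mem_nhdsWithin]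
      with t ht ht0
    rw [smul_eq_mul, inv_mul_lt_iff₀ ht0] at ht
    linarith
  obtain ⟨τ, hτ, hsub⟩ := mem_nhdsGT_iff_exists_Ioo_subset.1 h1
  -- For `t > h / 2` the allowed amount `-R' / 8 * t - R' / 16 * h` is below `-R' / 4 * t`, while
  -- `R` drops by at least `-R' / 2 * t`.
  obtain ⟨h, hh, hpos, hlt⟩ := (((ha (-R' / 8) (by linarith)).eventually_volume_le
    (η := -R' / 16) (κ := 1 / 16) (by linarith) (by norm_num)).and
    (Ioo_mem_nhdsGT hτ)).exists
  obtain ⟨t, ht, hA, -⟩ := exists_mem_Ioo_notMem_of_volume_le (p := h / 2) (q := h) (B := ∅)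
    (β := 0) (by positivity) le_rfl hh (by simp) (by linarith)
  simp only [mem_ofPred_eq, not_and, not_lt] at hA
  have h2 := hA ⟨by linarith [ht.1], ht.2⟩
  have h3 : R (x + t) - R x ≤ R' / 2 * t := hsub ⟨by linarith [ht.1], ht.2.trans hlt⟩
  nlinarith [ht.1, ht.2]

/-- A monotone function increases by at least the integral of its derivative. Here that derivative
is at least `k` almost everywhere, so the added slope can be removed. -/
theorem le_of_monotoneOn_add_mul {R : ℝ → ℝ} {x y k : ℝ} (hxy : x ≤ y)
    (hK : MonotoneOn (fun z => R z + k * z) (Icc x y))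
    (ha : ∀ᵐ z, ∀ β > 0, ApproxLE (fun t => R z - R (z + t)) β) : R x ≤ R y := by
  have hK' : MonotoneOn (fun z => R z + k * z) (uIcc x y) := by rwa [uIcc_of_le hxy]
  have hint := hK'.intervalIntegrable_deriv
  have hmem := hK'.intervalIntegral_deriv_mem_uIcc
  have hle : k * (y - x) ≤ ∫ z in x..y, deriv (fun z => R z + k * z) z := by
    have : ∫ _ in x..y, k = k * (y - x) := by simp [mul_comm]
    rw [← this]
    refine intervalIntegral.integral_mono_ae_restrict hxy (by simp) hint ?_
    have hend : ∀ᵐ z : ℝ, z ≠ x ∧ z ≠ y :=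
      (Measure.ae_ne volume x).and (Measure.ae_ne volume y)
    filter_upwards [ae_restrict_of_ae ha, ae_restrict_of_ae hend, hK.ae_differentiableWithinAt
      measurableSet_Icc, ae_restrict_mem measurableSet_Icc] with z h1 h2 h3 h4
    have hd : DifferentiableAt ℝ (fun z => R z + k * z) z := h3.differentiableAt
      (Icc_mem_nhds (lt_of_le_of_ne h4.1 h2.1.symm) (lt_of_le_of_ne h4.2 h2.2))
    have hdR : HasDerivAt R (deriv (fun z => R z + k * z) z - k) z := by
      have := hd.hasDerivAt.sub ((hasDerivAt_id z).const_mul k)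
      rw [mul_one] at this
      exact this.congr_of_eventuallyEq (.of_forall fun w => by simp)
    linarith [ApproxLE.deriv_nonneg hdR h1]
  have h1 : R x + k * x ≤ R y + k * y := hK (left_mem_Icc.2 hxy) (right_mem_Icc.2 hxy) hxy
  rw [uIcc_of_le (sub_nonneg.2 h1)] at hmem
  linarith [hmem.2]

/-- An approximately continuous function whose lower approximate derivates are nonnegative almost
everywhere and finite off a countable set is nondecreasing. -/
theorem monotone_of_approx {R : ℝ → ℝ} {C : Set ℝ} (hC : C.Countable)
    (hcr : ∀ x, ApproxSmall fun t => R (x + t) - R x)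
    (hcl : ∀ x, ApproxSmall fun t => R (x - t) - R x)
    (hbr : ∀ x ∉ C, ∃ β, ApproxLE (fun t => R x - R (x + t)) β)
    (hbl : ∀ x ∉ C, ∃ β, ApproxLE (fun t => R (x - t) - R x) β)
    (ha : ∀ᵐ x, ∀ β > 0, ApproxLE (fun t => R x - R (x + t)) β) : Monotone R := by
  suffices hG : ∀ x, x ∈ locallyMonotoneSet R from fun x y hxy =>
    le_of_Icc_subset_locallyMonotoneSet hxy fun z _ => hG z
  by_contra! hne
  obtain ⟨n, x₀, hx₀, ε₀, hε₀, hcl₀⟩ := exists_portion_subset_closure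
    (isOpen_locallyMonotoneSet R).isClosed_compl hne
    (fun x hx ε hε => exists_abs_sub_lt_notMem_locallyMonotoneSet hcr hcl hx hε) hC
    (E := uniformLowerSet R) (fun x _ => by
      by_cases hx : x ∈ C
      · exact Or.inl hx
      · exact Or.inr (mem_iUnion_uniformLowerSet (hbr x hx) (hbl x hx)))
  -- Two points of the portion, each moved by less than `ε`, stay within `4 * ε`, the range of the
  -- uniform estimate.
  obtain ⟨ε, hε, hε₁, hε₂⟩ : ∃ ε : ℝ, 0 < ε ∧ ε ≤ ε₀ ∧ 4 * ε ≤ 1 / (n + 1) :=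
    ⟨min ε₀ (1 / (4 * (n + 1))), by positivity, min_le_left _ _, by
      have := min_le_right ε₀ (1 / (4 * ((n : ℝ) + 1)))
      have h : 4 * (1 / (4 * ((n : ℝ) + 1))) = 1 / (n + 1) := by field_simp
      linarith⟩
  have hportion : ∀ x y, x ∉ locallyMonotoneSet R → y ∉ locallyMonotoneSet R →
      x ∈ Ioo (x₀ - ε) (x₀ + ε) → y ∈ Ioo (x₀ - ε) (x₀ + ε) → x ≤ y →
      R x + 2 * n * x ≤ R y + 2 * n * y := by
    intro x y hx hy hxI hyI hxy
    rcases hxy.eq_or_lt with rfl | hxy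
    · exact le_rfl
    refine le_of_forall_pos_le_add fun η hη => ?_
    obtain ⟨τ₁, hτ₁, h₁⟩ := eventually_abs_sub_le_of_mem_uniformLowerSet (hcr x) (hcl x) n
      (show 0 < η / 4 by positivity)
    obtain ⟨τ₂, hτ₂, h₂⟩ := eventually_abs_sub_le_of_mem_uniformLowerSet (hcr y) (hcl y) n
      (show 0 < η / 4 by positivity)
    have hτ₃ : 0 < min (min ((y - x) / 2) ε) (η / (8 * (n + 1))) := by
      have := sub_pos.2 hxy
      positivity
    have near : ∀ z ∉ locallyMonotoneSet R, z ∈ Ioo (x₀ - ε) (x₀ + ε) → ∀ τ > 0,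
        ∃ e ∈ uniformLowerSet R n, |e - z| < τ := by
      intro z hz hzI τ hτ
      obtain ⟨e, he, hd⟩ := Metric.mem_closure_iff.1 (hcl₀ z hz (by
        rw [abs_lt]; constructor <;> linarith [hzI.1, hzI.2])) τ hτ
      exact ⟨e, he, by rwa [dist_comm, Real.dist_eq] at hd⟩
    obtain ⟨e, he, hex⟩ := near x hx hxI _ (lt_min hτ₁ hτ₃)
    obtain ⟨e', he', hey⟩ := near y hy hyI _ (lt_min hτ₂ hτ₃)
    have h3 := abs_le.1 (h₁ e he (hex.trans_le (min_le_left _ _)))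
    have h4 := abs_le.1 (h₂ e' he' (hey.trans_le (min_le_left _ _)))
    have h5 := hex.trans_le (min_le_right _ _)
    have h6 := hey.trans_le (min_le_right _ _)
    simp only [lt_min_iff, abs_lt] at h5 h6
    have h7 := le_add_of_mem_uniformLowerSet he he' (by linarith) (by
      linarith [hxI.1, hxI.2, hyI.1, hyI.2])
    have h8 : n * (e' - y) ≤ η / 8 := by
      have := h6.2.2
      rw [lt_div_iff₀ (by positivity)] at this
      rcases le_or_gt (e' - y) 0 with h | h <;> nlinarith [(Nat.cast_nonneg n : (0 : ℝ) ≤ n)]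
    have h9 : n * (x - e) ≤ η / 8 := by
      have := h5.2.1
      rw [neg_lt, lt_div_iff₀ (by positivity)] at this
      rcases le_or_gt (x - e) 0 with h | h <;> nlinarith [(Nat.cast_nonneg n : (0 : ℝ) ≤ n)]
    nlinarith
  have hmono : MonotoneOn (fun z => R z + (2 * n) * z) (Ioo (x₀ - ε) (x₀ + ε)) := by
    intro x hx y hy hxy
    have hn : (0 : ℝ) ≤ 2 * n := by positivity
    rcases (Icc x y ∩ (locallyMonotoneSet R)ᶜ).eq_empty_or_nonempty with hemp | hne'
    · have h1 := le_of_Icc_subset_locallyMonotoneSet (R := R) hxy fun z hz => by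
        by_contra hz'
        exact (Set.ext_iff.1 hemp z).1 ⟨hz, hz'⟩
      exact add_le_add h1 (mul_le_mul_of_nonneg_left hxy hn)
    · have hcomp : IsCompact (Icc x y ∩ (locallyMonotoneSet R)ᶜ) :=
        isCompact_Icc.inter_right (isOpen_locallyMonotoneSet R).isClosed_compl
      -- Only the stretch between the first and last points of the complement needs the portion
      -- estimate; outside it `R` itself is nondecreasing.
      obtain ⟨p, hp⟩ := hcomp.exists_isLeast hne'
      obtain ⟨q, hq⟩ := hcomp.exists_isGreatest hne'
      have h1 := le_of_Ioo_subset_locallyMonotoneSet hcr hcl hp.1.1.1 fun z hz => by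
        by_contra hz'
        exact absurd (hp.2 ⟨⟨hz.1.le, hz.2.le.trans hp.1.1.2⟩, hz'⟩) (not_le.2 hz.2)
      have h2 := le_of_Ioo_subset_locallyMonotoneSet hcr hcl hq.1.1.2 fun z hz => by
        by_contra hz'
        exact absurd (hq.2 ⟨⟨hq.1.1.1.trans hz.1.le, hz.2.le⟩, hz'⟩) (not_le.2 hz.1)
      have h3 := hportion p q hp.1.2 hq.1.2 ⟨hx.1.trans_le hp.1.1.1, hp.1.1.2.trans_lt hy.2⟩
        ⟨hx.1.trans_le hq.1.1.1, hq.1.1.2.trans_lt hy.2⟩ (hp.2 hq.1)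
      have h4 := mul_le_mul_of_nonneg_left hp.1.1.1 hn
      have h5 := mul_le_mul_of_nonneg_left hq.1.1.2 hn
      simp only
      linarith
  exact hx₀ ⟨ε, hε, fun x hx y hy hxy => le_of_monotoneOn_add_mul hxy
    (hmono.mono (Icc_subset_Ioo hx.1 hy.2)) ha⟩

/-! ### Approximate minor functions -/

theorem ApproxLE.of_eqOn {D D' : ℝ → ℝ} {β τ : ℝ} (hD : ApproxLE D β) (hτ : 0 < τ)
    (h : EqOn D D' (Ioo 0 τ)) : ApproxLE D' β := by
  intro η hη
  filter_upwards [hD η hη, Ioo_mem_nhdsGT hτ] with k hk hkτ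
  refine (measure_mono ?_).trans hk
  rintro t ⟨ht, hlt⟩
  exact ⟨ht, by rwa [h ⟨ht.1, ht.2.trans hkτ.2⟩]⟩

theorem ApproxSmall.of_eqOn {D D' : ℝ → ℝ} {τ : ℝ} (hD : ApproxSmall D) (hτ : 0 < τ)
    (h : EqOn D D' (Ioo 0 τ)) : ApproxSmall D' := by
  intro η hη
  filter_upwards [hD η hη, Ioo_mem_nhdsGT hτ] with k hk hkτ
  refine (measure_mono ?_).trans hk
  rintro t ⟨ht, hlt⟩
  exact ⟨ht, by rwa [h ⟨ht.1, ht.2.trans hkτ.2⟩]⟩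

theorem approxLE_zero {β : ℝ} (hβ : 0 ≤ β) : ApproxLE (fun _ => 0) β := by
  intro η hη
  filter_upwards [self_mem_nhdsWithin] with h h0
  have : {t | t ∈ Ioo 0 h ∧ β * t + η * h < 0} = ∅ := by
    refine eq_empty_of_forall_notMem fun t ht => ?_
    have h1 := mul_nonneg hβ ht.1.1.le
    have h2 := mul_pos hη h0
    linarith [ht.2]
  rw [this, measure_empty]
  exact zero_le

theorem approxSmall_zero : ApproxSmall fun _ => 0 := by
  intro η hη
  simp [hη.le, not_lt.2]

theorem ApproxLE.add {D D' : ℝ → ℝ} {β β' : ℝ} (hD : ApproxLE D β) (hD' : ApproxLE D' β') :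
    ApproxLE (fun t => D t + D' t) (β + β') := by
  intro η hη
  filter_upwards [hD _ (half_pos hη), hD' _ (half_pos hη), self_mem_nhdsWithin] with h h1 h2 h0
  have h0' := mul_pos (half_pos hη) h0
  have heq : ENNReal.ofReal (η * h) = ENNReal.ofReal (η / 2 * h) + ENNReal.ofReal (η / 2 * h) := by
    rw [← ENNReal.ofReal_add h0'.le h0'.le]
    ring_nf
  rw [heq]
  refine (measure_mono ?_).trans ((measure_union_le _ _).trans (add_le_add h1 h2))
  rintro t ⟨ht, hlt⟩
  by_contra hcon
  simp only [mem_union, mem_ofPred_eq, ht, true_and, not_or, not_lt] at hcon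
  linarith

theorem ApproxSmall.add {D D' : ℝ → ℝ} (hD : ApproxSmall D) (hD' : ApproxSmall D') :
    ApproxSmall fun t => D t + D' t := by
  intro η hη
  filter_upwards [hD _ (half_pos hη), hD' _ (half_pos hη), self_mem_nhdsWithin] with h h1 h2 h0
  have h0' := mul_pos (half_pos hη) h0
  have heq : ENNReal.ofReal (η * h) = ENNReal.ofReal (η / 2 * h) + ENNReal.ofReal (η / 2 * h) := by
    rw [← ENNReal.ofReal_add h0'.le h0'.le]
    ring_nf
  rw [heq]
  refine (measure_mono ?_).trans ((measure_union_le _ _).trans (add_le_add h1 h2))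
  rintro t ⟨ht, hlt⟩
  by_contra hcon
  simp only [mem_union, mem_ofPred_eq, ht, true_and, not_or, not_lt] at hcon
  linarith [abs_add_le (D t) (D' t)]

theorem ApproxSmall.neg {D : ℝ → ℝ} (hD : ApproxSmall D) : ApproxSmall fun t => -D t := by
  simpa [ApproxSmall] using hD

/-- An approximate version of the defining properties of a minor function of `f` on `[c, d]`. -/
structure ApproxMinorOn (c d : ℝ) (f g : ℝ → ℝ) : Prop where
  right_cont : ∀ x ∈ Ico c d, ApproxSmall fun t => g (x + t) - g x
  left_cont : ∀ x ∈ Ioc c d, ApproxSmall fun t => g (x - t) - g x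
  ae_le : ∀ᵐ x, x ∈ Ioo c d → ∀ β > f x, ApproxLE (fun t => g (x + t) - g x) β
  exists_le : ∃ C : Set ℝ, C.Countable ∧ ∀ x ∈ Ioo c d, x ∉ C →
    (∃ β, ApproxLE (fun t => g (x + t) - g x) β) ∧ ∃ β, ApproxLE (fun t => g x - g (x - t)) β

theorem ApproxMinorOn.mono {c d c' d' : ℝ} {f g : ℝ → ℝ} (h : ApproxMinorOn c d f g)
    (hc : c ≤ c') (hd : d' ≤ d) : ApproxMinorOn c' d' f g where
  right_cont x hx := h.right_cont x (Ico_subset_Ico hc hd hx)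
  left_cont x hx := h.left_cont x (Ioc_subset_Ioc hc hd hx)
  ae_le := h.ae_le.mono fun _ hx hm => hx (Ioo_subset_Ioo hc hd hm)
  exists_le := by
    obtain ⟨C, hC, hx⟩ := h.exists_le
    exact ⟨C, hC, fun x hm => hx x (Ioo_subset_Ioo hc hd hm)⟩

/-- Upper bounds on increments add, and `f + (-f) = 0`. The negated sum is extended beyond `[c, d]`
by its end values so that `monotone_of_approx` applies on the line; `c` and `d` join the exceptional
set. -/
theorem ApproxMinorOn.antitoneOn_add {c d : ℝ} {f g₁ g₂ : ℝ → ℝ} (h₁ : ApproxMinorOn c d f g₁)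
    (h₂ : ApproxMinorOn c d (fun x => -f x) g₂) :
    AntitoneOn (fun x => g₁ x + g₂ x) (Icc c d) := by
  intro x₀ hx₀ y₀ hy₀ hxy₀
  have hcd : c ≤ d := hx₀.1.trans hx₀.2
  let proj : ℝ → ℝ := fun x => max c (min x d)
  have hproj : ∀ x, c ≤ x → x ≤ d → proj x = x := fun x h1 h2 => by simp [proj, h1, h2]
  have hproj_lo : ∀ x, x ≤ c → proj x = c := fun x h => by simp [proj, h]
  have hproj_hi : ∀ x, d ≤ x → proj x = d := fun x h => by simp [proj, h, hcd]
  let R : ℝ → ℝ := fun x => -(g₁ (proj x) + g₂ (proj x))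
  have hR : ∀ x, c ≤ x → x ≤ d → R x = -(g₁ x + g₂ x) := fun x h1 h2 => by
    simp only [R, hproj x h1 h2]
  have hR_lo : ∀ x, x ≤ c → R x = R c := fun x h => by
    simp only [R, hproj_lo x h, hproj_lo c le_rfl]
  have hR_hi : ∀ x, d ≤ x → R x = R d := fun x h => by
    simp only [R, hproj_hi x h, hproj_hi d le_rfl]
  obtain ⟨C₁, hC₁, hb₁⟩ := h₁.exists_le
  obtain ⟨C₂, hC₂, hb₂⟩ := h₂.exists_le
  have mid_right : ∀ x ∈ Ico c d, ∀ t ∈ Ioo 0 (d - x),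
      R (x + t) - R x = -((g₁ (x + t) - g₁ x) + (g₂ (x + t) - g₂ x)) := fun x hx t ht => by
    rw [hR x hx.1 hx.2.le, hR (x + t) (by linarith [hx.1, ht.1]) (by linarith [ht.2])]
    ring
  have mid_left : ∀ x ∈ Ioc c d, ∀ t ∈ Ioo 0 (x - c),
      R (x - t) - R x = -((g₁ (x - t) - g₁ x) + (g₂ (x - t) - g₂ x)) := fun x hx t ht => by
    rw [hR x hx.1.le hx.2, hR (x - t) (by linarith [ht.2]) (by linarith [hx.2, ht.1])]
    ring
  have out_right : ∀ x, x ∉ Ico c d → ∃ τ > 0, ∀ t ∈ Ioo 0 τ, R (x + t) - R x = 0 := by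
    intro x hx
    rcases lt_or_ge x c with h | h
    · refine ⟨c - x, sub_pos.2 h, fun t ht => ?_⟩
      rw [hR_lo x h.le, hR_lo (x + t) (by linarith [ht.2]), sub_self]
    · have hxd : d ≤ x := by
        by_contra! h'
        exact hx ⟨h, h'⟩
      refine ⟨1, one_pos, fun t ht => ?_⟩
      rw [hR_hi x hxd, hR_hi (x + t) (by linarith [ht.1]), sub_self]
  have out_left : ∀ x, x ∉ Ioc c d → ∃ τ > 0, ∀ t ∈ Ioo 0 τ, R (x - t) - R x = 0 := by
    intro x hx
    rcases lt_or_ge d x with h | h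
    · refine ⟨x - d, sub_pos.2 h, fun t ht => ?_⟩
      rw [hR_hi x h.le, hR_hi (x - t) (by linarith [ht.2]), sub_self]
    · have hxc : x ≤ c := by
        by_contra! h'
        exact hx ⟨h', h⟩
      refine ⟨1, one_pos, fun t ht => ?_⟩
      rw [hR_lo x hxc, hR_lo (x - t) (by linarith [ht.1]), sub_self]
  have hmono : Monotone R := by
    refine monotone_of_approx ((hC₁.union hC₂).union (countable_singleton c |>.insert d)) ?_ ?_ ?_ ?_ ?_
    · intro x
      by_cases hx : x ∈ Ico c d
      · exact ((h₁.right_cont x hx).add (h₂.right_cont x hx)).neg.of_eqOn (sub_pos.2 hx.2)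
          fun t ht => (mid_right x hx t ht).symm
      · obtain ⟨τ, hτ, h⟩ := out_right x hx
        exact approxSmall_zero.of_eqOn hτ fun t ht => (h t ht).symm
    · intro x
      by_cases hx : x ∈ Ioc c d
      · exact ((h₁.left_cont x hx).add (h₂.left_cont x hx)).neg.of_eqOn (sub_pos.2 hx.1)
          fun t ht => (mid_left x hx t ht).symm
      · obtain ⟨τ, hτ, h⟩ := out_left x hx
        exact approxSmall_zero.of_eqOn hτ fun t ht => (h t ht).symm
    · intro x hxC
      simp only [mem_union, mem_insert_iff, mem_singleton_iff, not_or] at hxC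
      by_cases hx : x ∈ Ico c d
      · have hx' : x ∈ Ioo c d := ⟨lt_of_le_of_ne hx.1 (Ne.symm hxC.2.2), hx.2⟩
        obtain ⟨⟨β₁, hβ₁⟩, -⟩ := hb₁ x hx' hxC.1.1
        obtain ⟨⟨β₂, hβ₂⟩, -⟩ := hb₂ x hx' hxC.1.2
        exact ⟨_, (hβ₁.add hβ₂).of_eqOn (sub_pos.2 hx.2)
          fun t ht => by linarith [mid_right x hx t ht]⟩
      · obtain ⟨τ, hτ, h⟩ := out_right x hx
        exact ⟨0, (approxLE_zero le_rfl).of_eqOn hτ fun t ht => by linarith [h t ht]⟩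
    · intro x hxC
      simp only [mem_union, mem_insert_iff, mem_singleton_iff, not_or] at hxC
      by_cases hx : x ∈ Ioo c d
      · obtain ⟨-, β₁, hβ₁⟩ := hb₁ x hx hxC.1.1
        obtain ⟨-, β₂, hβ₂⟩ := hb₂ x hx hxC.1.2
        exact ⟨_, (hβ₁.add hβ₂).of_eqOn (sub_pos.2 hx.1)
          fun t ht => by linarith [mid_left x ⟨hx.1, hx.2.le⟩ t ht]⟩
      · obtain ⟨τ, hτ, h⟩ := out_left x fun h => hx ⟨h.1, lt_of_le_of_ne h.2 hxC.2.1⟩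
        exact ⟨0, (approxLE_zero le_rfl).of_eqOn hτ fun t ht => by linarith [h t ht]⟩
    · filter_upwards [h₁.ae_le, h₂.ae_le, Measure.ae_ne volume c] with x h1 h2 hxc β hβ
      by_cases hx : x ∈ Ico c d
      · have hx' : x ∈ Ioo c d := ⟨lt_of_le_of_ne hx.1 (Ne.symm hxc), hx.2⟩
        have := (h1 hx' (f x + β / 2) (by linarith)).add (h2 hx' (-f x + β / 2) (by linarith))
        rw [show f x + β / 2 + (-f x + β / 2) = β by ring] at this
        exact this.of_eqOn (sub_pos.2 hx.2) fun t ht => by linarith [mid_right x hx t ht]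
      · obtain ⟨τ, hτ, h⟩ := out_right x hx
        exact (approxLE_zero hβ.le).of_eqOn hτ fun t ht => by linarith [h t ht]
  have := hmono hxy₀
  rw [hR x₀ hx₀.1 hx₀.2, hR y₀ hy₀.1 hy₀.2] at this
  simp only
  linarith

theorem HasDerivAt.approxLE {D : ℝ → ℝ} {D' β : ℝ} (hD : HasDerivAt D D' 0) (h0 : D 0 = 0)
    (hβ : D' < β) : ApproxLE D β := by
  have h1 : ∀ᶠ t in 𝓝[>] (0 : ℝ), D t ≤ β * t := by
    filter_upwards [hD.tendsto_slope_zero_right.eventually_lt_const hβ, self_mem_nhdsWithin]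
      with t ht ht0
    rw [smul_eq_mul, inv_mul_lt_iff₀ ht0, zero_add, h0] at ht
    linarith
  obtain ⟨τ, hτ, hsub⟩ := mem_nhdsGT_iff_exists_Ioo_subset.1 h1
  intro η hη
  filter_upwards [Ioo_mem_nhdsGT hτ] with h hh
  have : {t | t ∈ Ioo 0 h ∧ β * t + η * h < D t} = ∅ := by
    refine eq_empty_of_forall_notMem fun t ht => ?_
    have h1 : D t ≤ β * t := hsub ⟨ht.1.1, ht.1.2.trans hh.2⟩
    have h2 := mul_pos hη hh.1
    linarith [ht.2]
  rw [this, measure_empty]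
  exact zero_le

theorem ContinuousAt.approxSmall {D : ℝ → ℝ} (hD : ContinuousAt D 0) (h0 : D 0 = 0) :
    ApproxSmall D := by
  intro η hη
  have h1 : ∀ᶠ t in 𝓝[>] (0 : ℝ), |D t| < η := by
    have := hD.abs.eventually_lt_const (u := η) (by simpa [h0] using hη)
    exact this.filter_mono nhdsWithin_le_nhds
  obtain ⟨τ, hτ, hsub⟩ := mem_nhdsGT_iff_exists_Ioo_subset.1 h1
  filter_upwards [Ioo_mem_nhdsGT hτ] with h hh
  have : {t | t ∈ Ioo 0 h ∧ η < |D t|} = ∅ := by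
    refine eq_empty_of_forall_notMem fun t ht => ?_
    have h1 : |D t| < η := hsub ⟨ht.1.1, ht.1.2.trans hh.2⟩
    linarith [ht.2]
  rw [this, measure_empty]
  exact zero_le

/-- Inside a gap this makes `bumpSum` an approximate minor function of its own derivative, to be
paired with the negated major function. -/
theorem approxMinorOn_of_hasDerivAt {c d : ℝ} {f g : ℝ → ℝ}
    (h : ∀ x ∈ Icc c d, HasDerivAt g (f x) x) : ApproxMinorOn c d f g := by
  have hr : ∀ x ∈ Icc c d, HasDerivAt (fun t => g (x + t) - g x) (f x) 0 := fun x hx => by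
    have : HasDerivAt g (f x) (x + 0) := by simpa using h x hx
    simpa using (this.comp_const_add x 0).sub_const (g x)
  have hl : ∀ x ∈ Icc c d, HasDerivAt (fun t => g x - g (x - t)) (f x) 0 := fun x hx => by
    have : HasDerivAt g (f x) (x - 0) := by simpa using h x hx
    simpa using (this.comp_const_sub x 0).const_sub (g x)
  refine ⟨fun x hx => (hr x ⟨hx.1, hx.2.le⟩).continuousAt.approxSmall (by simp), fun x hx => ?_,
    .of_forall fun x hx β hβ => (hr x ⟨hx.1.le, hx.2.le⟩).approxLE (by simp) hβ,
    ∅, countable_empty, fun x hx _ => ⟨⟨f x + 1, ?_⟩, f x + 1, ?_⟩⟩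
  · simpa using ((hl x ⟨hx.1.le, hx.2⟩).continuousAt.approxSmall (by simp)).neg
  · exact (hr x ⟨hx.1.le, hx.2.le⟩).approxLE (by simp) (lt_add_one _)
  · exact (hl x ⟨hx.1.le, hx.2.le⟩).approxLE (by simp) (lt_add_one _)

/-! ### From `L^s` conditions to measure estimates -/

theorem volume_le_of_intervalIntegral_le {f : ℝ → ℝ} {h K c : ℝ} (h0 : 0 ≤ h)
    (hf : ∀ t, 0 ≤ f t) (hint : IntegrableOn f (Ioc 0 h)) (hc : 0 < c)
    (hK : ∫ t in (0 : ℝ)..h, f t ≤ K) :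
    volume {t | t ∈ Ioo 0 h ∧ c ≤ f t} ≤ ENNReal.ofReal (K / c) := by
  rw [intervalIntegral.integral_of_le h0] at hK
  have h1 := mul_meas_ge_le_integral_of_nonneg (.of_forall hf) hint c
  have h2 : (volume.restrict (Ioc 0 h)).real {t | c ≤ f t} ≤ K / c := by
    rw [le_div_iff₀ hc]
    linarith
  have h3 : volume ({t | c ≤ f t} ∩ Ioc 0 h) ≤ (volume.restrict (Ioc 0 h)) {t | c ≤ f t} :=
    Measure.le_restrict_apply _ _
  refine (measure_mono ?_).trans (h3.trans ?_)
  · rintro t ⟨ht, hle⟩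
    exact ⟨hle, ht.1, ht.2.le⟩
  · rw [← ENNReal.ofReal_toReal (measure_ne_top (volume.restrict (Ioc 0 h)) {t | c ≤ f t})]
    exact ENNReal.ofReal_le_ofReal h2

/-- A weak-type form of `∫₀ʰ [D t - β t]₊ dt = o(h²)`, for levels at least proportional to `h`. -/
def WeakLE (D : ℝ → ℝ) (β : ℝ) : Prop :=
  ∀ θ : ℝ, 0 < θ → ∀ η : ℝ, 0 < η → ∀ᶠ h in 𝓝[>] (0 : ℝ), ∀ l : ℝ, θ * h ≤ l →
    volume {t | t ∈ Ioo 0 h ∧ β * t + l < D t} ≤ ENNReal.ofReal (η * h ^ 2 / l)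

theorem WeakLE.approxLE {D : ℝ → ℝ} {β : ℝ} (hD : WeakLE D β) : ApproxLE D β := by
  intro η hη
  filter_upwards [hD η hη (η ^ 2) (by positivity), self_mem_nhdsWithin] with h hh h0
  have h0' : 0 < h := h0
  refine (hh _ le_rfl).trans_eq ?_
  congr 1
  field_simp

theorem integrableOn_max_rpow {D : ℝ → ℝ} {s τ : ℝ} (hs : 1 ≤ s)
    (hD : MemLp D (ENNReal.ofReal s) (volume.restrict (Ioc 0 τ))) (α : ℝ) :
    IntegrableOn (fun t => max (D t - α * t) 0 ^ s) (Ioc 0 τ) := by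
  have h1 : MemLp (fun t : ℝ => α * t) (ENNReal.ofReal s) (volume.restrict (Ioc 0 τ)) := by
    refine MemLp.of_bound (by fun_prop) (|α| * τ) ?_
    filter_upwards [ae_restrict_mem measurableSet_Ioc] with t ht
    rw [norm_mul, Real.norm_eq_abs, Real.norm_eq_abs, abs_of_pos ht.1]
    exact mul_le_mul_of_nonneg_left ht.2 (abs_nonneg _)
  have h2 := (hD.sub h1).pos_part.integrable_norm_rpow (by simp; linarith) (by simp)
  rw [ENNReal.toReal_ofReal (by linarith)] at h2
  refine h2.congr (.of_forall fun t => ?_)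
  simp only [Pi.sub_apply, Real.norm_eq_abs, abs_of_nonneg (le_max_right _ (0 : ℝ))]

/-- Chebyshev gives `o(h) ^ s * h / l ^ s`. Since `l ≥ θ h`, a factor `l ^ (s - 1)` dominates `(θ h)
^ (s - 1)`, and what remains is `o(h ^ 2) / l`, free of `s`. -/
theorem weakLE_of_isLittleO {D : ℝ → ℝ} {s τ α β : ℝ} (hs : 1 ≤ s) (hτ : 0 < τ)
    (hD : MemLp D (ENNReal.ofReal s) (volume.restrict (Ioc 0 τ)))
    (hα : (fun h : ℝ => ((1 / h) * ∫ t in (0 : ℝ)..h, (max (D t - α * t) 0) ^ s) ^ (1 / s))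
      =o[𝓝[>] 0] (fun h : ℝ => h)) (hαβ : α ≤ β) : WeakLE D β := by
  intro θ hθ η hη
  have hs0 : 0 < s := by linarith
  have hcp : 0 < η * θ ^ (s - 1) := by positivity
  have hc : 0 < (η * θ ^ (s - 1)) ^ (1 / s) := by positivity
  filter_upwards [hα.def hc, Ioo_mem_nhdsGT hτ] with h hh hhτ l hl
  have h0 : 0 < h := hhτ.1
  have hl0 : 0 < l := (mul_pos hθ h0).trans_le hl
  have hI : 0 ≤ (1 / h) * ∫ t in (0 : ℝ)..h, (max (D t - α * t) 0) ^ s :=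
    mul_nonneg (by positivity) (intervalIntegral.integral_nonneg h0.le fun t _ => by positivity)
  rw [Real.norm_of_nonneg (by positivity), Real.norm_of_nonneg h0.le] at hh
  have h1 := Real.rpow_le_rpow (by positivity) hh hs0.le
  rw [← Real.rpow_mul hI, one_div_mul_cancel hs0.ne', Real.rpow_one,
    Real.mul_rpow hc.le h0.le, ← Real.rpow_mul hcp.le, one_div_mul_cancel hs0.ne',
    Real.rpow_one, one_div, inv_mul_le_iff₀ h0] at h1
  have h2 := volume_le_of_intervalIntegral_le (c := l ^ s) h0.le (fun t => by positivity)
    ((integrableOn_max_rpow hs hD α).mono_set (Ioc_subset_Ioc_right hhτ.2.le)) (by positivity) h1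
  refine (measure_mono ?_).trans (h2.trans (ENNReal.ofReal_le_ofReal ?_))
  · rintro t ⟨ht, hlt⟩
    refine ⟨ht, Real.rpow_le_rpow hl0.le (le_max_of_le_left ?_) hs0.le⟩
    have := mul_le_mul_of_nonneg_right hαβ ht.1.le
    linarith
  · rw [div_le_div_iff₀ (by positivity) hl0]
    have e1 : h ^ s = h ^ (s - 1) * h := by
      rw [← Real.rpow_add_one h0.ne', sub_add_cancel]
    have e2 : l ^ s = l ^ (s - 1) * l := by
      rw [← Real.rpow_add_one hl0.ne', sub_add_cancel]
    have e3 : θ ^ (s - 1) * h ^ (s - 1) ≤ l ^ (s - 1) := by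
      rw [← Real.mul_rpow hθ.le h0.le]
      exact Real.rpow_le_rpow (by positivity) hl (by linarith)
    calc h * (η * θ ^ (s - 1) * h ^ s) * l
        = η * h ^ 2 * l * (θ ^ (s - 1) * h ^ (s - 1)) := by rw [e1]; ring
      _ ≤ η * h ^ 2 * l * l ^ (s - 1) := mul_le_mul_of_nonneg_left e3 (by positivity)
      _ = η * h ^ 2 * l ^ s := by rw [e2]; ring

/-- Chebyshev's inequality. The bound `A` leaves room for the two-sided integral in
`LrContinuousAt`, which dominates the integral over either side. -/
theorem approxSmall_of_tendsto {D : ℝ → ℝ} {s τ : ℝ} {A : ℝ → ℝ} (hs : 1 ≤ s) (hτ : 0 < τ)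
    (hD : MemLp D (ENNReal.ofReal s) (volume.restrict (Ioc 0 τ)))
    (hle : ∀ᶠ h in 𝓝[>] (0 : ℝ), ∫ t in (0 : ℝ)..h, |D t| ^ s ≤ A h)
    (hA : Tendsto (fun h : ℝ => ((1 / h) * A h) ^ (1 / s)) (𝓝[>] 0) (𝓝 0)) :
    ApproxSmall D := by
  intro η hη
  have hs0 : 0 < s := by linarith
  have hint : IntegrableOn (fun t => |D t| ^ s) (Ioc 0 τ) := by
    have h2 := hD.integrable_norm_rpow (by simp; linarith) (by simp)
    rw [ENNReal.toReal_ofReal (by linarith)] at h2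
    exact h2
  have hc : 0 < (η * η ^ s) ^ (1 / s) := by positivity
  filter_upwards [hle, hA.eventually_lt_const hc, Ioo_mem_nhdsGT hτ] with h h1 h2 hhτ
  have h0 : 0 < h := hhτ.1
  have hA0 : 0 ≤ A h :=
    (intervalIntegral.integral_nonneg h0.le fun t _ => by positivity).trans h1
  rw [Real.rpow_lt_rpow_iff (by positivity) (by positivity) (by positivity), one_div,
    inv_mul_lt_iff₀ h0] at h2
  have h3 := volume_le_of_intervalIntegral_le (c := η ^ s) h0.le (fun t => by positivity)
    (hint.mono_set (Ioc_subset_Ioc_right hhτ.2.le)) (by positivity) (h1.trans h2.le)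
  refine (measure_mono ?_).trans (h3.trans_eq ?_)
  · rintro t ⟨ht, hlt⟩
    exact ⟨ht, Real.rpow_le_rpow hη.le hlt.le hs0.le⟩
  · congr 1
    field_simp

theorem MemLr.right_increment {s a b : ℝ} {g : ℝ → ℝ} (hg : MemLr s a b g) {x : ℝ}
    (hx : a ≤ x) :
    MemLp (fun t => g (x + t) - g x) (ENNReal.ofReal s) (volume.restrict (Ioc 0 (b - x))) := by
  have h1 := hg.comp_measurePreserving
    ((measurePreserving_add_left volume x).restrict_preimage measurableSet_Icc)
  have h2 := h1.mono_measure (Measure.restrict_mono (s := Ioc 0 (b - x)) (fun t ht =>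
    show x + t ∈ Icc a b from ⟨by linarith [ht.1], by linarith [ht.2]⟩) le_rfl)
  exact h2.sub (memLp_const _)

theorem MemLr.left_increment {s a b : ℝ} {g : ℝ → ℝ} (hg : MemLr s a b g) {x : ℝ}
    (hx : x ≤ b) :
    MemLp (fun t => g (x - t) - g x) (ENNReal.ofReal s) (volume.restrict (Ioc 0 (x - a))) := by
  have h1 := hg.comp_measurePreserving
    ((Measure.measurePreserving_sub_left volume x).restrict_preimage measurableSet_Icc)
  have h2 := h1.mono_measure (Measure.restrict_mono (s := Ioc 0 (x - a)) (fun t ht =>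
    show x - t ∈ Icc a b from ⟨by linarith [ht.2], by linarith [ht.1]⟩) le_rfl)
  exact h2.sub (memLp_const _)

theorem MemLr.integrableOn_abs_sub_rpow {s a b : ℝ} {g : ℝ → ℝ} (hs : 1 ≤ s)
    (hg : MemLr s a b g) (k : ℝ) : IntegrableOn (fun y => |g y - k| ^ s) (Icc a b) := by
  have h2 := (MemLp.sub hg (memLp_const k)).integrable_norm_rpow (by simp; linarith) (by simp)
  rw [ENNReal.toReal_ofReal (by linarith)] at h2
  exact h2

theorem LrContinuousAt.right {s a b : ℝ} {g : ℝ → ℝ} (hs : 1 ≤ s) (hg : MemLr s a b g) {x : ℝ}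
    (hx : x ∈ Ico a b) (h : LrContinuousAt s a b g x) :
    ApproxSmall fun t => g (x + t) - g x := by
  refine approxSmall_of_tendsto hs (sub_pos.2 hx.2) (hg.right_increment hx.1) ?_ h
  filter_upwards [Ioo_mem_nhdsGT (sub_pos.2 hx.2)] with k hk
  rw [intervalIntegral.integral_comp_add_left (fun y => |g y - g x| ^ s) x, add_zero]
  have hint := hg.integrableOn_abs_sub_rpow hs (g x)
  rw [min_eq_right (by linarith [hk.2] : x + k ≤ b)]
  refine intervalIntegral.integral_mono_interval (max_le hx.1 (by linarith [hk.1]))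
    (by linarith [hk.1]) le_rfl (.of_forall fun y => by positivity) ?_
  rw [intervalIntegrable_iff_integrableOn_Ioc_of_le
    ((max_le hx.1 (by linarith [hk.1])).trans (by linarith [hk.1] : x ≤ x + k))]
  exact hint.mono_set fun y hy =>
    ⟨(le_max_left _ _).trans hy.1.le, hy.2.trans (by linarith [hk.2])⟩

theorem LrContinuousAt.left {s a b : ℝ} {g : ℝ → ℝ} (hs : 1 ≤ s) (hg : MemLr s a b g) {x : ℝ}
    (hx : x ∈ Ioc a b) (h : LrContinuousAt s a b g x) :
    ApproxSmall fun t => g (x - t) - g x := by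
  refine approxSmall_of_tendsto hs (sub_pos.2 hx.1) (hg.left_increment hx.2) ?_ h
  filter_upwards [Ioo_mem_nhdsGT (sub_pos.2 hx.1)] with k hk
  rw [intervalIntegral.integral_comp_sub_left (fun y => |g y - g x| ^ s) x, sub_zero]
  have hint := hg.integrableOn_abs_sub_rpow hs (g x)
  rw [max_eq_right (by linarith [hk.2] : a ≤ x - k)]
  refine intervalIntegral.integral_mono_interval le_rfl (by linarith [hk.1])
    (le_min hx.2 (by linarith [hk.1])) (.of_forall fun y => by positivity) ?_
  rw [intervalIntegrable_iff_integrableOn_Ioc_of_le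
    ((by linarith [hk.1] : x - k ≤ x).trans (le_min hx.2 (by linarith [hk.1])))]
  exact hint.mono_set fun y hy =>
    ⟨by linarith [hk.2, hy.1], hy.2.trans (min_le_left _ _)⟩

theorem weakLE_of_upperRightDerivate_lt {s a b : ℝ} {g : ℝ → ℝ} (hs : 1 ≤ s)
    (hg : MemLr s a b g) {x : ℝ} (hx : x ∈ Ico a b) {β : ℝ}
    (h : upperRightDerivate s g x < (β : EReal)) : WeakLE (fun t => g (x + t) - g x) β := by
  obtain ⟨_, ⟨α, hα, rfl⟩, hlt⟩ := sInf_lt_iff.1 h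
  exact weakLE_of_isLittleO hs (sub_pos.2 hx.2) (hg.right_increment hx.1) hα
    (EReal.coe_lt_coe_iff.1 hlt).le

theorem weakLE_of_upperLeftDerivate_lt {s a b : ℝ} {g : ℝ → ℝ} (hs : 1 ≤ s)
    (hg : MemLr s a b g) {x : ℝ} (hx : x ∈ Ioc a b) {β : ℝ}
    (h : upperLeftDerivate s g x < (β : EReal)) : WeakLE (fun t => g x - g (x - t)) β := by
  obtain ⟨_, ⟨α, hα, rfl⟩, hlt⟩ := sInf_lt_iff.1 h
  have h1 := (hg.left_increment hx.2).neg
  refine weakLE_of_isLittleO hs (sub_pos.2 hx.1) ?_ hα (EReal.coe_lt_coe_iff.1 hlt).le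
  refine h1.ae_eq (.of_forall fun t => ?_)
  simp

theorem upperRightDerivate_le_upperDerivate {s a b : ℝ} {g : ℝ → ℝ} {x : ℝ} (hx : x < b) :
    upperRightDerivate s g x ≤ upperDerivate s a b g x := by
  simp [upperDerivate, hx]

theorem upperLeftDerivate_le_upperDerivate {s a b : ℝ} {g : ℝ → ℝ} {x : ℝ} (hx : a < x) :
    upperLeftDerivate s g x ≤ upperDerivate s a b g x := by
  simp [upperDerivate, hx]

theorem exists_weakLE_of_upperDerivate_lt_top {s a b : ℝ} {g : ℝ → ℝ} (hs : 1 ≤ s)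
    (hg : MemLr s a b g) {x : ℝ} (hx : x ∈ Ico a b) (h : upperDerivate s a b g x < ⊤) :
    ∃ β, WeakLE (fun t => g (x + t) - g x) β := by
  obtain ⟨β, hβ, -⟩ := EReal.lt_iff_exists_real_btwn.1
    ((upperRightDerivate_le_upperDerivate hx.2).trans_lt h)
  exact ⟨β, weakLE_of_upperRightDerivate_lt hs hg hx hβ⟩

theorem IsLrMinor.approxMinorOn {s a b : ℝ} {f m : ℝ → ℝ} (hs : 1 ≤ s)
    (h : IsLrMinor s a b f m) : ApproxMinorOn a b f m where
  right_cont x hx := (h.continuousAt x ⟨hx.1, hx.2.le⟩).right hs h.memLr hx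
  left_cont x hx := (h.continuousAt x ⟨hx.1.le, hx.2⟩).left hs h.memLr hx
  ae_le := by
    filter_upwards [(ae_restrict_iff' measurableSet_Icc).1 h.derivate_le] with x hx hxI β hβ
    exact (weakLE_of_upperRightDerivate_lt hs h.memLr ⟨hxI.1.le, hxI.2⟩
      (((upperRightDerivate_le_upperDerivate hxI.2).trans
        (hx ⟨hxI.1.le, hxI.2.le⟩)).trans_lt (EReal.coe_lt_coe_iff.2 hβ))).approxLE
  exists_le := by
    refine ⟨_, h.derivate_lt_top, fun x hx hxC => ?_⟩
    have hlt : upperDerivate s a b m x < ⊤ := by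
      by_contra hcon
      exact hxC ⟨⟨hx.1.le, hx.2.le⟩, hcon⟩
    obtain ⟨β, hβ⟩ :=
      exists_weakLE_of_upperDerivate_lt_top hs h.memLr ⟨hx.1.le, hx.2⟩ hlt
    obtain ⟨γ, hγ, -⟩ := EReal.lt_iff_exists_real_btwn.1
      ((upperLeftDerivate_le_upperDerivate hx.1).trans_lt hlt)
    exact ⟨⟨β, hβ.approxLE⟩, γ,
      (weakLE_of_upperLeftDerivate_lt hs h.memLr ⟨hx.1, hx.2.le⟩ hγ).approxLE⟩

/-! ### Construction and geometry of the gaps -/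

noncomputable section

/-- Pairwise disjoint closed intervals in `(a, b)` with dense union, whose lengths have summable
`1/r`-th powers. -/
structure GapFamily (a b r : ℝ) where
  left : ℚ → ℝ
  width : ℚ → ℝ
  width_pos : ∀ q, 0 < width q
  summable : Summable fun q => width q ^ (1 / r)
  lt_left : ∀ q, a < left q
  right_lt : ∀ q, left q + width q < b
  right_lt_left_or : ∀ p q, p ≠ q → left p + width p < left q ∨ left q + width q < left p
  dense : ∀ c d, a ≤ c → c < d → d ≤ b →
    ∃ q, (Ioo c d ∩ Icc (left q) (left q + width q)).Nonempty

theorem tsum_indicator_add_le {w : ℚ → ℝ} (hw : ∀ q, 0 < w q) (hs : Summable w) {A B : Set ℚ}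
    (hAB : A ⊆ B) {s : ℚ} (hsA : s ∉ A) (hsB : s ∈ B) :
    ∑' q, A.indicator w q + w s ≤ ∑' q, B.indicator w q := by
  have h1 : ∑' q, ({s} : Set ℚ).indicator w q = w s := by
    rw [tsum_eq_single s fun q hq => indicator_of_notMem (by simpa using hq) _]
    simp
  rw [← h1, ← (hs.indicator A).tsum_add (hs.indicator {s})]
  refine Summable.tsum_le_tsum (fun q => ?_) ((hs.indicator A).add (hs.indicator {s}))
    (hs.indicator B)
  by_cases hqs : q = s
  · subst hqs
    simp [hsA, hsB]
  · have h2 : ({s} : Set ℚ).indicator w q = 0 := indicator_of_notMem (by simpa using hqs) _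
    rw [h2, add_zero]
    exact indicator_le_indicator_of_subset hAB (fun q => (hw q).le) q

/-- The weights are multiples of `2 ^ (-r k)` along an enumeration of `ℚ`; their `1/r`-th powers are
geometric of ratio 1/2. -/
theorem exists_summable_rpow_tsum_eq {r : ℝ} (hr : 1 ≤ r) {L : ℝ} (hL : 0 < L) :
    ∃ w : ℚ → ℝ, (∀ q, 0 < w q) ∧ (Summable fun q => w q ^ (1 / r)) ∧ HasSum w L := by
  have hr0 : 0 < r := by linarith
  have hgeom : ∀ x : ℝ, 0 < x → x < 1 → Summable fun q : ℚ => x ^ Encodable.encode q :=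
    fun x h0 h1 => (summable_geometric_of_lt_one h0.le h1).comp_injective
      Encodable.encode_injective
  have hx0 : (0 : ℝ) < (1 / 2) ^ r := by positivity
  have hx1 : (1 / 2 : ℝ) ^ r < 1 := Real.rpow_lt_one (by norm_num) (by norm_num) hr0
  have hs := hgeom _ hx0 hx1
  have hT : 0 < ∑' q : ℚ, ((1 / 2 : ℝ) ^ r) ^ Encodable.encode q :=
    hs.tsum_pos (fun q => by positivity) 0 (by positivity)
  refine ⟨fun q => L / (∑' q : ℚ, ((1 / 2 : ℝ) ^ r) ^ Encodable.encode q) *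
    ((1 / 2 : ℝ) ^ r) ^ Encodable.encode q, fun q => by positivity, ?_, ?_⟩
  · refine ((hgeom (1 / 2) (by norm_num) (by norm_num)).mul_left
      ((L / ∑' q : ℚ, ((1 / 2 : ℝ) ^ r) ^ Encodable.encode q) ^ (1 / r))).congr fun q => ?_
    rw [Real.mul_rpow (by positivity) (by positivity), ← Real.rpow_natCast (_ ^ r),
      ← Real.rpow_mul hx0.le, ← Real.rpow_mul (by norm_num), ← Real.rpow_natCast]
    congr 2
    field_simp
  · have := hs.hasSum.mul_left (L / ∑' q : ℚ, ((1 / 2 : ℝ) ^ r) ^ Encodable.encode q)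
    rwa [div_mul_cancel₀ _ hT.ne'] at this

/-- The gaps are laid out in the order of `ℚ`: gap `q` starts at `a` plus the total width of the
gaps `p < q`. A rational strictly between two others keeps their closed gaps apart. The widths add
up to `b - a`, so no interval can be left free. -/
theorem nonempty_gapFamily {a b r : ℝ} (hab : a < b) (hr : 1 ≤ r) :
    Nonempty (GapFamily a b r) := by
  obtain ⟨w, hw, hsum, hL⟩ := exists_summable_rpow_tsum_eq hr (sub_pos.2 hab)
  have hs := hL.summable
  let u : ℚ → ℝ := fun q => a + ∑' p, (Iio q).indicator w p
  have hlt : ∀ p q, p < q → u p + w p < u q := by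
    intro p q hpq
    have h1 := tsum_indicator_add_le hw hs (Iio_subset_Iic_self (a := p)) (s := p) (by simp)
      (by simp)
    obtain ⟨s, hps, hsq⟩ := exists_between hpq
    have h2 := tsum_indicator_add_le hw hs (Iic_subset_Iio.2 hpq) (s := s) (by simpa using hps)
      (by simpa using hsq)
    simp only [u]
    linarith [hw s]
  have hlo : ∀ q, a < u q := by
    intro q
    have h1 := tsum_indicator_add_le hw hs (empty_subset (Iio q)) (s := q - 1) (by simp) (by simp)
    simp only [indicator_empty, tsum_zero] at h1
    simp only [u]
    linarith [hw (q - 1)]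
  have hhi : ∀ q, u q + w q < b := by
    intro q
    have h1 := tsum_indicator_add_le hw hs (subset_univ (Iio (q + 1))) (s := q + 1) (by simp)
      (by simp)
    rw [indicator_univ, hL.tsum_eq] at h1
    have h2 := hlt q (q + 1) (by simp)
    simp only [u] at h2 ⊢
    linarith [hw (q + 1)]
  have hdisj : ∀ p q, p ≠ q → u p + w p < u q ∨ u q + w q < u p := fun p q hpq =>
    (lt_or_gt_of_ne hpq).imp (hlt p q) (hlt q p)
  refine ⟨⟨u, w, hw, hsum, hlo, hhi, hdisj, fun c d hac hcd hdb => ?_⟩⟩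
  by_contra! hcon
  have hpair : Pairwise (Function.onFun Disjoint fun q => Icc (u q) (u q + w q)) := by
    intro p q hpq
    refine Set.disjoint_left.2 fun x hx hx' => ?_
    rcases hdisj p q hpq with h | h <;> linarith [hx.1, hx.2, hx'.1, hx'.2]
  have hvol : volume (⋃ q, Icc (u q) (u q + w q)) = ENNReal.ofReal (b - a) := by
    rw [measure_iUnion hpair fun q => measurableSet_Icc]
    simp only [Real.volume_Icc, add_sub_cancel_left]
    rw [← ENNReal.ofReal_tsum_of_nonneg (fun q => (hw q).le) hs, hL.tsum_eq]
  have hd : Disjoint (Ioo c d) (⋃ q, Icc (u q) (u q + w q)) :=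
    disjoint_iUnion_right.2 fun q => disjoint_iff_inter_eq_empty.2 (hcon q)
  have hsub : Ioo c d ∪ ⋃ q, Icc (u q) (u q + w q) ⊆ Icc a b :=
    union_subset (Ioo_subset_Icc_self.trans (Icc_subset_Icc hac hdb))
      (iUnion_subset fun q => Icc_subset_Icc (hlo q).le (hhi q).le)
  have := measure_mono (μ := volume) hsub
  rw [measure_union hd (.iUnion fun q => measurableSet_Icc), hvol, Real.volume_Ioo,
    Real.volume_Icc, ← ENNReal.ofReal_add (by linarith) (by linarith),
    ENNReal.ofReal_le_ofReal_iff (by linarith)] at this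
  linarith

namespace GapFamily

variable {a b r : ℝ} (G : GapFamily a b r)

/-- The open gap. -/
def gap (q : ℚ) : Set ℝ := Ioo (G.left q) (G.left q + G.width q)

/-- What the open gaps leave of `[a, b]`. -/
def residue : Set ℝ := Icc a b \ ⋃ q, G.gap q

theorem isClosed_residue : IsClosed G.residue :=
  isClosed_Icc.sdiff (isOpen_iUnion fun _ => isOpen_Ioo)

theorem width_lt (q : ℚ) : G.width q < b - a := by
  linarith [G.lt_left q, G.right_lt q]

theorem notMem_gap {x : ℝ} (hx : x ∈ G.residue) (q : ℚ) : x ∉ G.gap q := fun h =>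
  hx.2 (mem_iUnion.2 ⟨q, h⟩)

theorem left_mem_residue (q : ℚ) : G.left q ∈ G.residue := by
  refine ⟨⟨(G.lt_left q).le, by linarith [G.right_lt q, G.width_pos q]⟩, fun h => ?_⟩
  obtain ⟨p, hp⟩ := mem_iUnion.1 h
  rcases eq_or_ne p q with rfl | hpq
  · exact lt_irrefl _ hp.1
  · rcases G.right_lt_left_or p q hpq with h | h
    · linarith [hp.2]
    · linarith [hp.1, G.width_pos q]

theorem exists_gap_right {x ε : ℝ} (hx : x ∈ G.residue) (hxb : x < b)
    (hne : ∀ q, G.left q ≠ x) (hε : 0 < ε) :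
    ∃ q, x < G.left q ∧ G.left q + G.width q < x + ε := by
  have key : ∀ d, x < d → d ≤ b → ∃ q, x < G.left q ∧ G.left q < d := by
    intro d hxd hdb
    obtain ⟨q, y, hy, hyq⟩ := G.dense x d hx.1.1 hxd hdb
    refine ⟨q, lt_of_not_ge fun h => G.notMem_gap hx q ⟨lt_of_le_of_ne h (hne q), ?_⟩, ?_⟩
    · linarith [hy.1, hyq.2]
    · linarith [hy.2, hyq.1]
  obtain ⟨q, hq, hq'⟩ := key (min b (x + ε)) (lt_min hxb (by linarith)) (min_le_left _ _)
  -- Gap `q` starts before `x + ε` but may end after it; a gap between `x` and `q` cannot.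
  obtain ⟨p, hp, hp'⟩ := key (G.left q) hq (by linarith [G.right_lt q, G.width_pos q])
  refine ⟨p, hp, ?_⟩
  have := lt_min_iff.1 hq'
  rcases G.right_lt_left_or p q (by rintro rfl; exact lt_irrefl _ hp') with h | h
  · linarith
  · linarith [G.width_pos q]

theorem exists_gap_left {x ε : ℝ} (hx : x ∈ G.residue) (hxa : a < x)
    (hne : ∀ q, G.left q + G.width q ≠ x) (hε : 0 < ε) :
    ∃ q, x - ε < G.left q ∧ G.left q + G.width q < x := by
  have key : ∀ c, c < x → a ≤ c → ∃ q, c < G.left q + G.width q ∧ G.left q + G.width q < x := by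
    intro c hcx hac
    obtain ⟨q, y, hy, hyq⟩ := G.dense c x hac hcx hx.1.2
    refine ⟨q, ?_, lt_of_not_ge fun h => G.notMem_gap hx q ⟨?_, lt_of_le_of_ne h (hne q).symm⟩⟩
    · linarith [hy.1, hyq.2]
    · linarith [hy.2, hyq.1]
  obtain ⟨q, hq, hq'⟩ := key (max a (x - ε)) (max_lt hxa (by linarith)) (le_max_left _ _)
  obtain ⟨p, hp, hp'⟩ := key (G.left q + G.width q) hq' (by linarith [G.lt_left q, G.width_pos q])
  refine ⟨p, ?_, hp'⟩
  have := max_lt_iff.1 hq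
  rcases G.right_lt_left_or p q (by rintro rfl; exact lt_irrefl _ hp) with h | h
  · linarith [G.width_pos q]
  · linarith

/-- Later, points with good uniform bounds are sought immediately to the left of a gap; this shows
that the residue reaches there. -/
theorem left_approx (q : ℚ) {ε : ℝ} (hε : 0 < ε) :
    ∃ y ∈ G.residue, y < G.left q ∧ G.left q - ε < y := by
  obtain ⟨p, hp, hp'⟩ := G.exists_gap_left (G.left_mem_residue q) (G.lt_left q) (fun p h => by
    rcases eq_or_ne p q with rfl | hpq
    · linarith [G.width_pos p]
    · rcases G.right_lt_left_or p q hpq with h | h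
      · linarith
      · linarith [G.width_pos q, G.width_pos p]) hε
  exact ⟨_, G.left_mem_residue p, by linarith [G.width_pos p], hp⟩

/-- The point `b` and left ends of gaps are approached from the left, all other points of the
residue from the right. In particular the residue is perfect. -/
theorem exists_gap_near (hab : a < b) {x ε : ℝ} (hx : x ∈ G.residue) (hε : 0 < ε) :
    ∃ q, G.left q ≠ x ∧ x - ε < G.left q ∧ G.left q + G.width q < x + ε := by
  by_cases h : x < b ∧ ∀ q, G.left q ≠ x
  · obtain ⟨q, h1, h2⟩ := G.exists_gap_right hx h.1 h.2 hε
    exact ⟨q, h1.ne', by linarith, h2⟩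
  · have hx' : a < x ∧ ∀ q, G.left q + G.width q ≠ x := by
      rcases eq_or_lt_of_le hx.1.2 with rfl | hlt
      · exact ⟨hab, fun q => (G.right_lt q).ne⟩
      · push Not at h
        obtain ⟨q, rfl⟩ := h hlt
        refine ⟨G.lt_left q, fun p hp => ?_⟩
        rcases eq_or_ne p q with rfl | hpq
        · linarith [G.width_pos p]
        · rcases G.right_lt_left_or p q hpq with h | h
          · linarith
          · linarith [G.width_pos q, G.width_pos p]
    obtain ⟨q, h1, h2⟩ := G.exists_gap_left hx hx'.1 hx'.2 hε
    exact ⟨q, by linarith [G.width_pos q], h1, by linarith⟩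

theorem infinite_gaps_near (hab : a < b) {x ε : ℝ} (hx : x ∈ G.residue) (hε : 0 < ε) :
    {q | x - ε < G.left q ∧ G.left q + G.width q < x + ε}.Infinite := by
  intro hfin
  have hev : ∀ᶠ δ in 𝓝[>] (0 : ℝ), ∀ q ∈ hfin.toFinset, G.left q ≠ x → δ ≤ |G.left q - x| := by
    refine (eventually_all_finset _).2 fun q _ => ?_
    by_cases h : G.left q = x
    · simp [h]
    · filter_upwards [Ioo_mem_nhdsGT (abs_pos.2 (sub_ne_zero.2 h))] with δ hδ _ using hδ.2.le
  obtain ⟨δ, h1, hδ, hδε⟩ := (hev.and (Ioo_mem_nhdsGT hε)).exists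
  obtain ⟨q, hq, h2, h3⟩ := G.exists_gap_near hab hx hδ
  have h4 := h1 q (by
    rw [Set.Finite.mem_toFinset]
    exact ⟨by linarith, by linarith⟩) hq
  have h5 : |G.left q - x| < δ := by
    rw [abs_lt]
    constructor <;> linarith [G.width_pos q]
  linarith

theorem finite_le_width (hr : 1 ≤ r) {θ : ℝ} (hθ : 0 < θ) : {q | θ ≤ G.width q}.Finite := by
  have h1 := G.summable.tendsto_cofinite_zero.eventually_lt_const
    (show 0 < θ ^ (1 / r) by positivity)
  refine (eventually_cofinite.1 h1).subset fun q hq => ?_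
  exact not_lt.2 (Real.rpow_le_rpow hθ.le hq (by positivity))

end GapFamily

end

/-! ### The sum of the bumps -/

noncomputable section

namespace GapFamily

variable {a b r : ℝ} (G : GapFamily a b r)

/-- The half-width of the support of the bump in a gap. -/
def radius (q : ℚ) : ℝ := G.width q ^ 2 / (6 * (b - a))

theorem length_pos (G : GapFamily a b r) : 0 < b - a := (G.width_pos 0).trans (G.width_lt 0)

theorem radius_pos (q : ℚ) : 0 < G.radius q :=
  div_pos (pow_pos (G.width_pos q) 2) (mul_pos (by norm_num) (G.length_pos))

theorem radius_le (q : ℚ) : G.radius q ≤ G.width q / 6 := by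
  have h1 := G.length_pos
  rw [radius, div_le_div_iff₀ (by positivity) (by norm_num)]
  nlinarith [G.width_lt q, G.width_pos q]

/-- The bump of height `1` centred in a gap. -/
def bump (q : ℚ) : ContDiffBump (G.left q + G.width q / 2) where
  rIn := G.radius q / 2
  rOut := G.radius q
  rIn_pos := half_pos (G.radius_pos q)
  rIn_lt_rOut := half_lt_self (G.radius_pos q)

theorem bump_eq_zero {q : ℚ} {y : ℝ} (hy : y ∉ G.gap q) : G.bump q y = 0 := by
  refine (G.bump q).zero_of_le_dist ((G.radius_le q).trans ?_)
  rw [Real.dist_eq, le_abs]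
  have := G.width_pos q
  rcases le_or_gt y (G.left q) with h | h
  · right
    linarith
  · left
    have : G.left q + G.width q ≤ y := by
      by_contra! h'
      exact hy ⟨h, h'⟩
    linarith

/-- The sum of the bumps. -/
def bumpSum (y : ℝ) : ℝ := ∑' q, G.bump q y

theorem bumpSum_eq_bump {q : ℚ} {y : ℝ} (hy : y ∈ G.gap q) : G.bumpSum y = G.bump q y := by
  refine tsum_eq_single q fun p hp => G.bump_eq_zero fun hyp => ?_
  rcases G.right_lt_left_or p q hp with h | h <;> linarith [hy.1, hy.2, hyp.1, hyp.2]

theorem bumpSum_eq_zero {y : ℝ} (hy : ∀ q, y ∉ G.gap q) : G.bumpSum y = 0 := by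
  simp [bumpSum, G.bump_eq_zero (hy _)]

theorem bumpSum_nonneg (y : ℝ) : 0 ≤ G.bumpSum y := tsum_nonneg fun q => (G.bump q).nonneg

theorem bumpSum_le_one (y : ℝ) : G.bumpSum y ≤ 1 := by
  by_cases h : ∃ q, y ∈ G.gap q
  · obtain ⟨q, hq⟩ := h
    exact (G.bumpSum_eq_bump hq).trans_le (G.bump q).le_one
  · push Not at h
    simp [G.bumpSum_eq_zero h]

theorem exists_mem_ball_of_bumpSum_ne_zero {y : ℝ} (hy : G.bumpSum y ≠ 0) :
    ∃ q, |y - (G.left q + G.width q / 2)| < G.radius q := by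
  by_contra! h
  exact hy (by
    have : ∀ q, G.bump q y = 0 := fun q => (G.bump q).zero_of_le_dist (h q)
    simp [bumpSum, this])

theorem measurable_bumpSum : Measurable G.bumpSum := by
  exact Measurable.tsum fun q => (G.bump q).continuous.measurable

theorem memLr_bumpSum (s : ℝ) : MemLr s a b G.bumpSum :=
  MemLp.of_bound G.measurable_bumpSum.aestronglyMeasurable 1 (.of_forall fun y => by
    rw [Real.norm_of_nonneg (G.bumpSum_nonneg y)]
    exact G.bumpSum_le_one y)

theorem hasDerivAt_bumpSum {q : ℚ} {y : ℝ} (hy : y ∈ G.gap q) :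
    HasDerivAt G.bumpSum (deriv G.bumpSum y) y := by
  have h1 : DifferentiableAt ℝ (G.bump q) y :=
    ((G.bump q).contDiff (n := 1)).differentiable (by simp) y
  refine (h1.congr_of_eventuallyEq ?_).hasDerivAt
  filter_upwards [isOpen_Ioo.mem_nhds hy] with z hz using G.bumpSum_eq_bump hz

/-- `bumpSum` has its minimum 0 at such a point. If it is not differentiable there, `deriv` is 0 by
default. -/
theorem deriv_bumpSum_eq_zero {y : ℝ} (hy : ∀ q, y ∉ G.gap q) : deriv G.bumpSum y = 0 := by
  refine IsLocalMin.deriv_eq_zero (.of_forall fun z => ?_)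
  rw [G.bumpSum_eq_zero hy]
  exact G.bumpSum_nonneg z

end GapFamily

/-! ### HK_r-integrability of the derivative -/

theorem sum_volume_inter_le {n : ℕ} {c d : Fin n → ℝ}
    (hdisj : ∀ i j, i ≠ j → Disjoint (Ioo (c i) (d i)) (Ioo (c j) (d j))) {V : Set ℝ}
    (hV : MeasurableSet V) (hfin : volume V ≠ ⊤) (s : Finset (Fin n)) :
    ∑ i ∈ s, volume.real (Ioo (c i) (d i) ∩ V) ≤ volume.real V := by
  rw [← measureReal_biUnion_finset (fun i _ j _ hij =>
      (hdisj i j hij).mono inter_subset_left inter_subset_left)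
    (fun i _ => measurableSet_Ioo.inter hV)
    (fun i _ => ne_top_of_le_ne_top hfin (measure_mono inter_subset_right))]
  exact measureReal_mono (iUnion₂_subset fun i _ => inter_subset_right) hfin

theorem sum_sub_le {n : ℕ} {a b : ℝ} {c d : Fin n → ℝ} (hab : a ≤ b)
    (hcd : ∀ i, a ≤ c i ∧ c i ≤ d i ∧ d i ≤ b)
    (hdisj : ∀ i j, i ≠ j → Disjoint (Ioo (c i) (d i)) (Ioo (c j) (d j))) :
    ∑ i, (d i - c i) ≤ b - a := by
  have h1 := sum_volume_inter_le hdisj (V := Icc a b) measurableSet_Icc (by simp) Finset.univ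
  rw [Real.volume_real_Icc_of_le hab] at h1
  refine le_of_eq_of_le (Finset.sum_congr rfl fun i _ => ?_) h1
  rw [inter_eq_left.2 (Ioo_subset_Icc_self.trans (Icc_subset_Icc (hcd i).1 (hcd i).2.2)),
    Real.volume_real_Ioo_of_le (hcd i).2.1]

theorem indicator_const_mul_apply {ι : Type*} (Q : Set ι) (k : ℝ) (f : ι → ℝ) (q : ι) :
    Q.indicator (fun q => k * f q) q = k * Q.indicator f q := by
  by_cases h : q ∈ Q <;> simp [h]

/-- The contraction of `ℓ¹` into `ℓʳ`: each term is at most the whole sum. -/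
theorem tsum_rpow_rpow_le {ι : Type*} {z : ι → ℝ} {r : ℝ} (hr : 1 ≤ r) (hz : ∀ q, 0 ≤ z q)
    (hs : Summable z) : Summable (fun q => z q ^ r) ∧ (∑' q, z q ^ r) ^ (1 / r) ≤ ∑' q, z q := by
  have hr0 : 0 < r := by linarith
  have hS : 0 ≤ ∑' q, z q := tsum_nonneg hz
  have hle : ∀ q, z q ^ r ≤ z q * (∑' q, z q) ^ (r - 1) := fun q => by
    rcases (hz q).eq_or_lt with h | h
    · rw [← h, Real.zero_rpow hr0.ne', zero_mul]
    · rw [show r = (r - 1) + 1 by ring, Real.rpow_add_one h.ne', mul_comm, add_sub_cancel_right]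
      exact mul_le_mul_of_nonneg_left (Real.rpow_le_rpow h.le
        (hs.le_tsum q fun p _ => hz p) (by linarith)) h.le
  have hsum : Summable fun q => z q ^ r :=
    .of_nonneg_of_le (fun q => Real.rpow_nonneg (hz q) r) hle (hs.mul_right _)
  refine ⟨hsum, ?_⟩
  have h1 := hsum.tsum_le_tsum hle (hs.mul_right _)
  rw [tsum_mul_right] at h1
  have h2 : (∑' q, z q) * (∑' q, z q) ^ (r - 1) ≤ (∑' q, z q) ^ r := by
    rcases hS.eq_or_lt with h | h
    · rw [← h, zero_mul, Real.zero_rpow hr0.ne']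
    · rw [mul_comm, ← Real.rpow_add_one h.ne', sub_add_cancel]
  have h3 := Real.rpow_le_rpow (tsum_nonneg fun q => Real.rpow_nonneg (hz q) r) (h1.trans h2)
    (one_div_nonneg.2 hr0.le)
  rwa [← Real.rpow_mul hS, mul_one_div_cancel hr0.ne', Real.rpow_one] at h3

namespace GapFamily

variable {a b r : ℝ} (G : GapFamily a b r)

/-- The gaps at least a third of which lies in `[c, d]`. -/
def hit (c d : ℝ) : Set ℚ := {q | G.width q ≤ 3 * volume.real (Ioo c d ∩ G.gap q)}

theorem mem_hit_iff {c d : ℝ} {q : ℚ} :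
    q ∈ G.hit c d ↔ G.width q ≤ 3 * volume.real (Ioo c d ∩ G.gap q) := Iff.rfl

theorem width_le_of_mem_hit {c d : ℝ} (hcd : c ≤ d) {q : ℚ} (hq : q ∈ G.hit c d) :
    G.width q ≤ 3 * (d - c) := by
  have := measureReal_mono (μ := volume) (inter_subset_left : Ioo c d ∩ G.gap q ⊆ Ioo c d)
    (by simp)
  rw [Real.volume_real_Ioo_of_le hcd] at this
  have h := G.mem_hit_iff.1 hq
  linarith

/-- The bump lives in the middle third of its gap. An interval reaching from outside the gap into
the bump therefore crosses an outer third. -/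
theorem mem_hit {c d x y : ℝ} {q : ℚ} (hx : x ∈ Icc c d) (hxq : x ∉ G.gap q)
    (hy : y ∈ Ioo c d) (hyq : |y - (G.left q + G.width q / 2)| < G.radius q) :
    q ∈ G.hit c d ∧ G.width q / 3 ≤ |y - x| := by
  have hrad := G.radius_le q
  rw [abs_lt] at hyq
  have hw := G.width_pos q
  have hfin : volume (Ioo c d ∩ G.gap q) ≠ ⊤ :=
    ne_top_of_le_ne_top (by simp) (measure_mono (inter_subset_left : _ ⊆ Ioo c d))
  rcases le_or_gt x (G.left q) with h | h
  · have hsub : Ioo (G.left q) y ⊆ Ioo c d ∩ G.gap q := fun z hz =>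
      ⟨⟨by linarith [hx.1, hz.1], hz.2.trans hy.2⟩, hz.1, by linarith [hz.2]⟩
    have := measureReal_mono hsub hfin
    rw [Real.volume_real_Ioo_of_le (by linarith)] at this
    exact ⟨G.mem_hit_iff.2 (by linarith), le_abs.2 (Or.inl (by linarith))⟩
  · have h' : G.left q + G.width q ≤ x := by
      by_contra! h'
      exact hxq ⟨h, h'⟩
    have hsub : Ioo y (G.left q + G.width q) ⊆ Ioo c d ∩ G.gap q := fun z hz =>
      ⟨⟨hy.1.trans hz.1, by linarith [hx.2, hz.2]⟩, by linarith [hz.1], hz.2⟩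
    have := measureReal_mono hsub hfin
    rw [Real.volume_real_Ioo_of_le (by linarith)] at this
    exact ⟨G.mem_hit_iff.2 (by linarith), le_abs.2 (Or.inr (by linarith))⟩

/-- At most three nonoverlapping intervals can each take a third of the same gap. -/
theorem sum_indicator_hit_le {n : ℕ} {c d : Fin n → ℝ}
    (hdisj : ∀ i j, i ≠ j → Disjoint (Ioo (c i) (d i)) (Ioo (c j) (d j))) (q : ℚ) {z : ℝ}
    (hz : 0 ≤ z) : ∑ i, (G.hit (c i) (d i)).indicator (fun _ => z) q ≤ 3 * z := by
  have hw := G.width_pos q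
  have h1 := sum_volume_inter_le hdisj (V := G.gap q) measurableSet_Ioo (by simp [gap])
    Finset.univ
  rw [gap, Real.volume_real_Ioo_of_le (by linarith), add_sub_cancel_left] at h1
  have h2 : ∀ i, (G.hit (c i) (d i)).indicator (fun _ => z) q ≤
      3 * z / G.width q * volume.real (Ioo (c i) (d i) ∩ G.gap q) := fun i => by
    by_cases h : q ∈ G.hit (c i) (d i)
    · rw [indicator_of_mem h, div_mul_eq_mul_div, le_div_iff₀ hw]
      have h' := G.mem_hit_iff.1 h
      nlinarith
    · rw [indicator_of_notMem h]
      positivity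
  calc _ ≤ ∑ i, 3 * z / G.width q * volume.real (Ioo (c i) (d i) ∩ G.gap q) :=
        Finset.sum_le_sum fun i _ => h2 i
    _ = 3 * z / G.width q * ∑ i, volume.real (Ioo (c i) (d i) ∩ G.gap q) := by
        rw [Finset.mul_sum]
    _ ≤ 3 * z / G.width q * G.width q := mul_le_mul_of_nonneg_left h1 (by positivity)
    _ = 3 * z := by field_simp

theorem volume_biUnion_ball_le (Q : Set ℚ) (hsum : Summable (Q.indicator G.radius)) :
    volume.real (⋃ q ∈ Q, Metric.ball (G.left q + G.width q / 2) (G.radius q)) ≤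
      ∑' q, Q.indicator (fun q => 2 * G.radius q) q ∧
    volume (⋃ q ∈ Q, Metric.ball (G.left q + G.width q / 2) (G.radius q)) ≠ ⊤ := by
  have hnn : ∀ q, 0 ≤ Q.indicator (fun q => 2 * G.radius q) q :=
    indicator_nonneg fun q _ => by linarith [G.radius_pos q]
  have hsum' : Summable (Q.indicator fun q => 2 * G.radius q) :=
    (hsum.mul_left 2).congr fun q => (indicator_const_mul_apply Q 2 G.radius q).symm
  have h1 : volume (⋃ q ∈ Q, Metric.ball (G.left q + G.width q / 2) (G.radius q)) ≤
      ENNReal.ofReal (∑' q, Q.indicator (fun q => 2 * G.radius q) q) := by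
    rw [ENNReal.ofReal_tsum_of_nonneg hnn hsum']
    refine (measure_iUnion_le _).trans (ENNReal.tsum_le_tsum fun q => ?_)
    by_cases h : q ∈ Q
    · simp [h, Real.volume_ball]
    · simp [h]
  exact ⟨ENNReal.toReal_le_of_le_ofReal (tsum_nonneg hnn) h1,
    ne_top_of_le_ne_top ENNReal.ofReal_ne_top h1⟩

/-- Since `w ≤ 3 (d - c)` for a hit gap, its bump has support of length `w ^ 2 / (3 (b - a)) ≤ (d -
c) w / (b - a)`, which cancels the averaging factor. `tsum_rpow_rpow_le` then takes the `1/r`-th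
power inside the sum. -/
theorem mean_bumpSum_rpow_le (hr : 1 ≤ r) {c d : ℝ} (hcd : c < d) {Q : Set ℚ}
    (hQ : Q ⊆ G.hit c d)
    (hball : ∀ y ∈ Ioo c d, ∀ q, |y - (G.left q + G.width q / 2)| < G.radius q → q ∈ Q) :
    ((1 / (d - c)) * ∫ y in c..d, |G.bumpSum y| ^ r) ^ (1 / r) ≤
      (1 / (b - a)) ^ (1 / r) * ∑' q, Q.indicator (fun q => G.width q ^ (1 / r)) q := by
  have hr0 : 0 < r := by linarith
  have hab : 0 < b - a := G.length_pos
  have hdc : 0 < d - c := sub_pos.2 hcd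
  obtain ⟨hs, hle⟩ := tsum_rpow_rpow_le hr (fun q => indicator_nonneg
    (fun q _ => Real.rpow_nonneg (G.width_pos q).le (1 / r)) q) (G.summable.indicator Q)
  have hrp : ∀ q, Q.indicator (fun q => G.width q ^ (1 / r)) q ^ r = Q.indicator G.width q := by
    intro q
    by_cases h : q ∈ Q
    · simp only [indicator_of_mem h]
      rw [← Real.rpow_mul (G.width_pos q).le, one_div_mul_cancel hr0.ne', Real.rpow_one]
    · simp only [indicator_of_notMem h]
      exact Real.zero_rpow hr0.ne'
  simp only [hrp] at hs hle
  have hrad : ∀ q, Q.indicator (fun q => 2 * G.radius q) q ≤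
      (d - c) / (b - a) * Q.indicator G.width q := by
    intro q
    by_cases h : q ∈ Q
    · simp only [indicator_of_mem h]
      have h1 := G.width_le_of_mem_hit hcd.le (hQ h)
      rw [radius, div_mul_eq_mul_div, ← mul_div_assoc, div_le_div_iff₀ (by positivity) hab]
      have h2 := mul_le_mul_of_nonneg_right h1 (mul_pos (G.width_pos q) hab).le
      nlinarith
    · simp [indicator_of_notMem h]
  have hrs : Summable (Q.indicator G.radius) := by
    have : Summable fun q => Q.indicator (fun q => 2 * G.radius q) q :=
      .of_nonneg_of_le (indicator_nonneg fun q _ => by linarith [G.radius_pos q]) hrad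
        (hs.mul_left _)
    refine (this.mul_left (1 / 2)).congr fun q => ?_
    rw [indicator_const_mul_apply]
    ring
  obtain ⟨hvol, hfin⟩ := G.volume_biUnion_ball_le Q hrs
  set V := ⋃ q ∈ Q, Metric.ball (G.left q + G.width q / 2) (G.radius q) with hVdef
  have hVm : MeasurableSet V := .biUnion (to_countable Q) fun q _ => measurableSet_ball
  have hint : ∫ y in c..d, |G.bumpSum y| ^ r ≤ volume.real V := by
    rw [intervalIntegral.integral_of_le hcd.le, integral_Ioc_eq_integral_Ioo]
    calc ∫ y in Ioo c d, |G.bumpSum y| ^ r ≤ ∫ y in Ioo c d, V.indicator 1 y := by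
          refine integral_mono_of_nonneg (.of_forall fun y => by positivity)
            ((integrable_const (1 : ℝ)).indicator hVm) ?_
          filter_upwards [ae_restrict_mem measurableSet_Ioo] with y hy
          by_cases h : G.bumpSum y = 0
          · simp only [h, abs_zero, Real.zero_rpow hr0.ne']
            exact indicator_nonneg (fun _ _ => zero_le_one) y
          · obtain ⟨q, hq⟩ := G.exists_mem_ball_of_bumpSum_ne_zero h
            have hyV : y ∈ V := mem_iUnion₂.2 ⟨q, hball y hy q hq, hq⟩
            simp only [indicator_of_mem hyV, Pi.one_apply]
            refine Real.rpow_le_one (abs_nonneg _) ?_ hr0.le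
            rw [abs_of_nonneg (G.bumpSum_nonneg y)]
            exact G.bumpSum_le_one y
      _ = (volume.restrict (Ioo c d)).real V := integral_indicator_one hVm
      _ ≤ volume.real V := ENNReal.toReal_mono hfin (Measure.restrict_apply_le _ _)
  have h3 : volume.real V ≤ (d - c) / (b - a) * ∑' q, Q.indicator G.width q := by
    rw [← tsum_mul_left]
    exact hvol.trans (Summable.tsum_le_tsum hrad ((hrs.mul_left 2).congr fun q =>
      (indicator_const_mul_apply Q 2 G.radius q).symm) (hs.mul_left _))
  have h4 : (1 / (d - c)) * ∫ y in c..d, |G.bumpSum y| ^ r ≤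
      1 / (b - a) * ∑' q, Q.indicator G.width q := by
    calc _ ≤ (1 / (d - c)) * ((d - c) / (b - a) * ∑' q, Q.indicator G.width q) :=
          mul_le_mul_of_nonneg_left (hint.trans h3) (by positivity)
      _ = _ := by field_simp
  have h0 : 0 ≤ ∑' q, Q.indicator G.width q :=
    tsum_nonneg (indicator_nonneg fun q _ => (G.width_pos q).le)
  have h5 := Real.rpow_le_rpow (mul_nonneg (by positivity)
    (intervalIntegral.integral_nonneg hcd.le fun y _ => by positivity)) h4
    (one_div_nonneg.2 hr0.le)
  rw [Real.mul_rpow (by positivity) h0] at h5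
  exact h5.trans (mul_le_mul_of_nonneg_left hle (by positivity))

theorem mean_rpow_le_of_abs_le {r c d ε x : ℝ} {D : ℝ → ℝ} (hr : 1 ≤ r) (hcd : c < d)
    (hε : 0 ≤ ε) (hx : x ∈ Icc c d) (hD : ∀ y ∈ Icc c d, |D y| ≤ ε * |y - x|) :
    ((1 / (d - c)) * ∫ y in c..d, |D y| ^ r) ^ (1 / r) ≤ ε * (d - c) := by
  have hr0 : 0 < r := by linarith
  have hdc : 0 < d - c := sub_pos.2 hcd
  have h1 : ∫ y in c..d, |D y| ^ r ≤ (ε * (d - c)) ^ r * (d - c) := by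
    rw [intervalIntegral.integral_of_le hcd.le]
    calc ∫ y in Ioc c d, |D y| ^ r ≤ ∫ _ in Ioc c d, (ε * (d - c)) ^ r := by
          refine integral_mono_of_nonneg (.of_forall fun y => by positivity)
            (integrable_const _) ?_
          filter_upwards [ae_restrict_mem measurableSet_Ioc] with y hy
          refine Real.rpow_le_rpow (abs_nonneg _) ((hD y ⟨hy.1.le, hy.2⟩).trans
            (mul_le_mul_of_nonneg_left ?_ hε)) hr0.le
          rw [abs_le]
          constructor <;> linarith [hy.1, hy.2, hx.1, hx.2]
      _ = _ := by simp [hcd.le, mul_comm]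
  have h2 : (1 / (d - c)) * ∫ y in c..d, |D y| ^ r ≤ (ε * (d - c)) ^ r := by
    rw [one_div, inv_mul_le_iff₀ hdc]
    linarith
  have h3 := Real.rpow_le_rpow (mul_nonneg (by positivity)
    (intervalIntegral.integral_nonneg hcd.le fun y _ => by positivity)) h2
    (one_div_nonneg.2 hr0.le)
  rwa [← Real.rpow_mul (by positivity), mul_one_div_cancel hr0.ne', Real.rpow_one] at h3

theorem exists_finset_tsum_indicator_lt {z : ℚ → ℝ} {ε : ℝ} (hε : 0 < ε) :
    ∃ S : Finset ℚ, ∑' q, ((S : Set ℚ)ᶜ).indicator z q < ε := by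
  obtain ⟨S, hS⟩ := ((tendsto_tsum_compl_atTop_zero z).eventually_lt_const hε).exists
  refine ⟨S, ?_⟩
  rw [← tsum_subtype]
  exact hS

theorem hkIntegrable_deriv_bumpSum (hr : 1 ≤ r) : HKIntegrable r a b (deriv G.bumpSum) := by
  have hab : 0 < b - a := G.length_pos
  refine ⟨G.bumpSum, G.memLr_bumpSum r, fun ε hε => ?_⟩
  set K := (1 / (b - a)) ^ (1 / r) with hK
  have hK0 : 0 < K := by positivity
  -- Each gap is counted up to three times with factor `K`, so this tail costs less than `ε / 2`;
  -- the tags inside gaps cost the other half.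
  obtain ⟨S, hS⟩ := exists_finset_tsum_indicator_lt
    (z := fun q => G.width q ^ (1 / r)) (show 0 < ε / (6 * K) by positivity)
  -- By `mem_hit`, a `δ₀`-fine interval tagged in the residue is too short to reach the bump of a
  -- gap in `S`.
  obtain ⟨δ₀, hδ₀, hδ₀S⟩ : ∃ δ₀ : ℝ, 0 < δ₀ ∧ ∀ q ∈ S, δ₀ ≤ G.width q / 3 := by
    have : ∀ᶠ δ in 𝓝[>] (0 : ℝ), ∀ q ∈ S, δ ≤ G.width q / 3 :=
      (eventually_all_finset S).2 fun q _ => by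
        filter_upwards [Ioo_mem_nhdsGT (show 0 < G.width q / 3 by
          linarith [G.width_pos q])] with δ hδ using hδ.2.le
    obtain ⟨δ, h1, h2⟩ := (this.and self_mem_nhdsWithin).exists
    exact ⟨δ, h2, h1⟩
  have hε' : 0 < ε / (2 * (b - a)) := by positivity
  have hgauge : ∀ x, ∃ δ : ℝ, 0 < δ ∧ ((∀ q, x ∉ G.gap q) → δ ≤ δ₀) ∧
      ((∃ q, x ∈ G.gap q) → ∀ y, |y - x| < δ →
        |G.bumpSum y - G.bumpSum x - deriv G.bumpSum x * (y - x)| ≤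
          ε / (2 * (b - a)) * |y - x|) := by
    intro x
    by_cases h : ∃ q, x ∈ G.gap q
    · obtain ⟨q, hq⟩ := h
      have h1 := (hasDerivAt_iff_isLittleO.1 (G.hasDerivAt_bumpSum hq)).def hε'
      obtain ⟨δ, hδ, hsub⟩ := Metric.eventually_nhds_iff.1 h1
      refine ⟨δ, hδ, fun h => absurd hq (h q), fun _ y hy => ?_⟩
      have := hsub (show dist y x < δ from hy)
      simpa only [smul_eq_mul, Real.norm_eq_abs, mul_comm] using this
    · exact ⟨δ₀, hδ₀, fun _ => le_rfl, fun h' => absurd h' h⟩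
  choose δ hδ hδout hδin using hgauge
  refine ⟨δ, fun x _ => hδ x, fun n c d x hcd hx hfine hdisj => ?_⟩
  let z : ℚ → ℝ := ((S : Set ℚ)ᶜ).indicator fun q => G.width q ^ (1 / r)
  have hz : ∀ q, 0 ≤ z q := indicator_nonneg fun q _ => Real.rpow_nonneg (G.width_pos q).le _
  have hzs : Summable z := G.summable.indicator _
  have hterm : ∀ i, ((1 / (d i - c i)) * ∫ y in (c i)..(d i),
      |G.bumpSum y - G.bumpSum (x i) - deriv G.bumpSum (x i) * (y - x i)| ^ r) ^ (1 / r) ≤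
      ε / (2 * (b - a)) * (d i - c i) +
        K * ∑' q, (G.hit (c i) (d i)).indicator z q := by
    intro i
    have hB : 0 ≤ K * ∑' q, (G.hit (c i) (d i)).indicator z q :=
      mul_nonneg hK0.le (tsum_nonneg (indicator_nonneg fun q _ => hz q))
    have hA : 0 ≤ ε / (2 * (b - a)) * (d i - c i) :=
      mul_nonneg hε'.le (by linarith [(hcd i).2.1])
    by_cases hin : ∃ q, x i ∈ G.gap q
    · refine (mean_rpow_le_of_abs_le hr (hcd i).2.1 hε'.le (hx i) fun y hy => ?_).trans
        (le_add_of_nonneg_right hB)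
      have := hfine i hy
      exact hδin (x i) hin y (by rw [abs_lt]; constructor <;> linarith [this.1, this.2])
    · push Not at hin
      simp only [G.bumpSum_eq_zero hin, G.deriv_bumpSum_eq_zero hin, sub_zero, zero_mul]
      refine (G.mean_bumpSum_rpow_le hr (hcd i).2.1
        (Q := G.hit (c i) (d i) ∩ (S : Set ℚ)ᶜ) inter_subset_left fun y hy q hq => ?_).trans ?_
      · obtain ⟨h1, h2⟩ := G.mem_hit (hx i) (hin q) hy hq
        refine ⟨h1, fun hqS => ?_⟩
        have h3 := hfine i ⟨hy.1.le, hy.2.le⟩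
        have h4 : |y - x i| < δ (x i) := by
          rw [abs_lt]; constructor <;> linarith [h3.1, h3.2]
        linarith [hδout (x i) hin, hδ₀S q hqS]
      · rw [← indicator_indicator]
        exact le_add_of_nonneg_left hA
  have hcount : ∑ i, ∑' q, (G.hit (c i) (d i)).indicator z q ≤ 3 * ∑' q, z q := by
    rw [← Summable.tsum_finsetSum fun i _ => hzs.indicator _, ← tsum_mul_left]
    refine Summable.tsum_le_tsum (fun q => ?_) (summable_sum fun i _ => hzs.indicator _)
      (hzs.mul_left 3)
    exact G.sum_indicator_hit_le hdisj q (hz q)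
  have hlen := sum_sub_le (by linarith) (fun i => ⟨(hcd i).1, (hcd i).2.1.le, (hcd i).2.2⟩) hdisj
  calc _ ≤ ∑ i, (ε / (2 * (b - a)) * (d i - c i) +
        K * ∑' q, (G.hit (c i) (d i)).indicator z q) := Finset.sum_le_sum fun i _ => hterm i
    _ = ε / (2 * (b - a)) * ∑ i, (d i - c i) +
        K * ∑ i, ∑' q, (G.hit (c i) (d i)).indicator z q := by
        rw [Finset.sum_add_distrib, Finset.mul_sum, Finset.mul_sum]
    _ ≤ ε / (2 * (b - a)) * (b - a) + K * (3 * ∑' q, z q) :=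
        add_le_add (mul_le_mul_of_nonneg_left hlen hε'.le)
          (mul_le_mul_of_nonneg_left hcount hK0.le)
    _ < ε / (2 * (b - a)) * (b - a) + K * (3 * (ε / (6 * K))) := by
        have := mul_lt_mul_of_pos_left (mul_lt_mul_of_pos_left hS three_pos) hK0
        linarith
    _ = ε := by field_simp; ring

end GapFamily

end

/-! ### Failure of P_s-integrability -/

noncomputable section

/-- The intervals `(R (y i), R (x i))` are disjoint and lie in `[R b, R a]`. -/
theorem AntitoneOn.sum_sub_le {R : ℝ → ℝ} {a b : ℝ} (hab : a ≤ b) (hR : AntitoneOn R (Icc a b))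
    {n : ℕ} {x y : Fin n → ℝ} (hxy : ∀ i, a ≤ x i ∧ x i ≤ y i ∧ y i ≤ b)
    (hord : ∀ i j, i ≠ j → y i ≤ x j ∨ y j ≤ x i) :
    ∑ i, (R (x i) - R (y i)) ≤ R a - R b := by
  have hx : ∀ i, x i ∈ Icc a b := fun i => ⟨(hxy i).1, (hxy i).2.1.trans (hxy i).2.2⟩
  have hy : ∀ i, y i ∈ Icc a b := fun i => ⟨(hxy i).1.trans (hxy i).2.1, (hxy i).2.2⟩
  have ha : a ∈ Icc a b := left_mem_Icc.2 hab
  have hb : b ∈ Icc a b := right_mem_Icc.2 hab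
  refine _root_.sum_sub_le (hR ha hb hab) (fun i => ⟨hR (hy i) hb (hy i).2,
    hR (hx i) (hy i) (hxy i).2.1, hR ha (hx i) (hx i).1⟩) fun i j hij => ?_
  refine Set.disjoint_left.2 fun z hz hz' => ?_
  rcases hord i j hij with h | h
  · linarith [hR (hy i) (hx j) h, hz.1, hz'.2]
  · linarith [hR (hy j) (hx i) h, hz.2, hz'.1]

namespace GapFamily

variable {a b r : ℝ} (G : GapFamily a b r)

/-- The points of the residue at which the increments of `g`, at scales below `1/(n+1)`, exceed
slope `n` by more than `1/4` only on sets of measure at most `η h²`. -/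
def weakUpperSet (g : ℝ → ℝ) (η : ℝ) (n : ℕ) : Set ℝ :=
  {x | x ∈ G.residue ∧ ∀ h : ℝ, 0 < h → h < 1 / (n + 1) →
    volume {t | t ∈ Ioo 0 h ∧ n * t + 1 / 4 < g (x + t) - g x} ≤ ENNReal.ofReal (η * h ^ 2)}

theorem exists_forall_mem_weakUpperSet {g : ℝ → ℝ} {η x β : ℝ} (hη : 0 < η) (hx : x ∈ G.residue)
    (hg : WeakLE (fun t => g (x + t) - g x) β) :
    ∃ N : ℕ, ∀ n : ℕ, N ≤ n → x ∈ G.weakUpperSet g η n := by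
  -- For `h < 1/4` the fixed level 1/4 is admissible with `θ = 1`, and `(η / 4) h ^ 2 / (1 / 4) = η
  -- h ^ 2`.
  have h1 := (hg 1 one_pos (η / 4) (by positivity)).and
    (Ioo_mem_nhdsGT (show (0 : ℝ) < 1 / 4 by norm_num))
  obtain ⟨τ, hτ, hsub⟩ := mem_nhdsGT_iff_exists_Ioo_subset.1 h1
  obtain ⟨N₁, hN₁⟩ := exists_nat_gt β
  obtain ⟨N₂, hN₂⟩ := exists_nat_one_div_lt (mem_Ioi.1 hτ)
  refine ⟨max N₁ N₂, fun n hn => ⟨hx, fun h h0 hlt => ?_⟩⟩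
  have e1 : (N₁ : ℝ) ≤ n := by exact_mod_cast (le_max_left _ _).trans hn
  have e2 : (N₂ : ℝ) ≤ n := by exact_mod_cast (le_max_right _ _).trans hn
  obtain ⟨h2, h3⟩ := hsub ⟨h0, hlt.trans (lt_of_le_of_lt
    (one_div_le_one_div_of_le (by positivity) (by linarith)) hN₂)⟩
  refine (measure_mono ?_).trans ((h2 (1 / 4) (by linarith [h3.2])).trans_eq ?_)
  · rintro t ⟨ht, hlt⟩
    have := mul_le_mul_of_nonneg_right (hN₁.le.trans e1) ht.1.le
    exact ⟨ht, by linarith⟩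
  · congr 1
    ring

/-- A weak upper bound for the increments of `m` and `M` at a point close to a gap on its left
forces `m + M` to drop by `1/4` across the gap, if `bumpSum + M` is nonincreasing in the gap. -/
theorem exists_drop {m M : ℝ → ℝ} {n : ℕ} {x : ℝ} {q : ℚ}
    (hmx : x ∈ G.weakUpperSet m (1 / (48 * (b - a))) n)
    (hMx : x ∈ G.weakUpperSet M (1 / (48 * (b - a))) n)
    (hM : ∀ y z, z ∈ G.gap q → y ∈ G.gap q → z ≤ y →
      G.bumpSum y + M y ≤ G.bumpSum z + M z)
    (hxl : x < G.left q) (hxq : G.left q - G.width q < x)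
    (hw : G.width q < 1 / (16 * (n + 1))) :
    ∃ y ∈ G.gap q, m y + M y ≤ m x + M x - 1 / 4 := by
  have hab := G.length_pos
  have hw0 := G.width_pos q
  set h := G.left q + G.width q - x with hh
  have h0 : 0 < h := by linarith
  have h2w : h < 2 * G.width q := by linarith
  have hn1 : 16 * G.width q * (n + 1) < 1 := by
    rw [lt_div_iff₀ (by positivity)] at hw
    linarith
  have hhn : h < 1 / (n + 1) := by
    rw [lt_div_iff₀ (by positivity)]
    nlinarith [(Nat.cast_nonneg n : (0 : ℝ) ≤ n)]
  -- As `h < 2 w`, the bad set has measure at most `w ^ 2 / (12 (b - a))`, half the radius, whereas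
  -- the plateau has length equal to the radius.
  have hbad : 1 / (48 * (b - a)) * h ^ 2 ≤ G.radius q / 2 := by
    have : h ^ 2 ≤ (2 * G.width q) ^ 2 := pow_le_pow_left₀ h0.le h2w.le 2
    rw [radius, div_mul_eq_mul_div, one_mul, div_div, div_le_div_iff₀ (by positivity)
      (by positivity)]
    nlinarith
  have hrad := G.radius_pos q
  have hrad' := G.radius_le q
  -- Here `y` is a good point for `m` on the plateau, and `z` below is a good point for `M` in the
  -- left third, before the bump.
  obtain ⟨y, hy, hyA, -⟩ := exists_mem_Ioo_notMem_of_volume_le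
    (p := G.left q + G.width q / 2 - G.radius q / 2)
    (q := G.left q + G.width q / 2 + G.radius q / 2) (B := ∅) (β := 0) (half_pos hrad).le le_rfl
    (((volume_preimage_sub_right x _).trans_le (hmx.2 h h0 hhn)).trans
      (ENNReal.ofReal_le_ofReal hbad)) (by simp) (by linarith)
  obtain ⟨z, hz, hzA, -⟩ := exists_mem_Ioo_notMem_of_volume_le
    (p := G.left q) (q := G.left q + G.width q / 3) (B := ∅) (β := 0) (half_pos hrad).le le_rfl
    (((volume_preimage_sub_right x _).trans_le (hMx.2 h h0 hhn)).trans
      (ENNReal.ofReal_le_ofReal hbad)) (by simp) (by linarith)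
  simp only [mem_preimage, mem_ofPred_eq, not_and, not_lt, add_sub_cancel] at hyA hzA
  have hygap : y ∈ G.gap q := ⟨by linarith [hy.1], by linarith [hy.2]⟩
  have hzgap : z ∈ G.gap q := ⟨hz.1, by linarith [hz.2]⟩
  have h1 := hyA ⟨by linarith [hygap.1], by linarith [hygap.2]⟩
  have h2 := hzA ⟨by linarith [hzgap.1], by linarith [hzgap.2]⟩
  have h3 := hM y z hzgap hygap (by linarith [hz.2, hy.1])
  have hFy : G.bumpSum y = 1 := by
    rw [G.bumpSum_eq_bump hygap]
    refine (G.bump q).one_of_mem_closedBall ?_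
    rw [Metric.mem_closedBall, Real.dist_eq, abs_le]
    exact ⟨show -(G.radius q / 2) ≤ _ by linarith [hy.1],
      show _ ≤ G.radius q / 2 by linarith [hy.2]⟩
  have hFz : G.bumpSum z = 0 := by
    rw [G.bumpSum_eq_bump hzgap]
    refine (G.bump q).zero_of_le_dist ?_
    rw [Real.dist_eq, le_abs]
    exact Or.inr (show G.radius q ≤ _ by linarith [hz.2])
  refine ⟨y, hygap, ?_⟩
  have hn0 : (0 : ℝ) ≤ n := Nat.cast_nonneg n
  have h4 : n * (y - x) ≤ n * (2 * G.width q) :=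
    mul_le_mul_of_nonneg_left (by linarith [hygap.2]) hn0
  have h5 : n * (z - x) ≤ n * (2 * G.width q) :=
    mul_le_mul_of_nonneg_left (by linarith [hzgap.2]) hn0
  rw [hFy, hFz] at h3
  -- The balance is `1/4 + 1/4 - 1 + 4 n w`, and `16 n w < 1`.
  nlinarith

theorem not_perronIntegrable_deriv_bumpSum (hr : 1 ≤ r) {s : ℝ} (hs : 1 ≤ s) :
    ¬ PerronIntegrable s a b (deriv G.bumpSum) := by
  intro hP
  have hab : a < b := _root_.sub_pos.1 G.length_pos
  -- The closeness of the two functions plays no role: a single pair is already contradictory.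
  obtain ⟨M', m, hMaj, hMin, -⟩ := hP 1 one_pos
  obtain ⟨M, hM⟩ : ∃ M : ℝ → ℝ, M = fun x => -M' x := ⟨_, rfl⟩
  have hMin' : IsLrMinor s a b (fun x => -deriv G.bumpSum x) M := hM ▸ hMaj
  have hm := hMin.approxMinorOn hs
  have hMm := hMin'.approxMinorOn hs
  have hanti : AntitoneOn (fun x => m x + M x) (Icc a b) := hm.antitoneOn_add hMm
  have hgap : ∀ q, ∀ y z, z ∈ G.gap q → y ∈ G.gap q → z ≤ y →
      G.bumpSum y + M y ≤ G.bumpSum z + M z := by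
    intro q y z hz hy hzy
    have hF : ApproxMinorOn z y (deriv G.bumpSum) G.bumpSum :=
      approxMinorOn_of_hasDerivAt fun x hx =>
        G.hasDerivAt_bumpSum (q := q) ⟨hz.1.trans_le hx.1, hx.2.trans_lt hy.2⟩
    exact hF.antitoneOn_add (hMm.mono (by linarith [G.lt_left q, hz.1])
      (by linarith [G.right_lt q, hy.2])) (left_mem_Icc.2 hzy) (right_mem_Icc.2 hzy) hzy
  have hη : 0 < 1 / (48 * (b - a)) := by
    have := G.length_pos
    positivity
  obtain ⟨n, x₀, hx₀, ε, hε, hcl⟩ := exists_portion_subset_closure G.isClosed_residue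
    ⟨_, G.left_mem_residue 0⟩
    (fun x hx ε hε => by
      obtain ⟨q, h1, h2, h3⟩ := G.exists_gap_near hab hx hε
      exact ⟨_, G.left_mem_residue q, h1, by
        rw [abs_lt]; constructor <;> linarith [G.width_pos q]⟩)
    -- The point `b` is discarded because it has no right-hand derivate.
    ((hMin.derivate_lt_top.union hMin'.derivate_lt_top).union (countable_singleton b))
    (E := fun n => G.weakUpperSet m (1 / (48 * (b - a))) n ∩
      G.weakUpperSet M (1 / (48 * (b - a))) n) (fun x hx => by
      by_cases hC : x ∈ ({x ∈ Icc a b | ¬upperDerivate s a b m x < ⊤} ∪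
        {x ∈ Icc a b | ¬upperDerivate s a b M x < ⊤}) ∪ {b}
      · exact Or.inl hC
      · right
        simp only [mem_union, mem_ofPred_eq, mem_singleton_iff, not_or, not_and, not_not] at hC
        have hxI : x ∈ Ico a b := ⟨hx.1.1, lt_of_le_of_ne hx.1.2 hC.2⟩
        obtain ⟨β, hβ⟩ := exists_weakLE_of_upperDerivate_lt_top hs hMin.memLr hxI (hC.1.1 hx.1)
        obtain ⟨γ, hγ⟩ := exists_weakLE_of_upperDerivate_lt_top hs hMin'.memLr hxI (hC.1.2 hx.1)
        obtain ⟨N₁, h₁⟩ := G.exists_forall_mem_weakUpperSet hη hx hβ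
        obtain ⟨N₂, h₂⟩ := G.exists_forall_mem_weakUpperSet hη hx hγ
        exact mem_iUnion.2 ⟨max N₁ N₂, h₁ _ (le_max_left _ _), h₂ _ (le_max_right _ _)⟩)
  have hinf := (G.infinite_gaps_near hab hx₀ hε).sdiff
    (G.finite_le_width hr (θ := 1 / (16 * ((n : ℝ) + 1))) (by positivity))
  -- With `k` drops of 1/4 the total exceeds the whole decrease of `m + M` on `[a, b]`.
  obtain ⟨k, hk⟩ := exists_nat_gt (4 * ((m a + M a) - (m b + M b)))
  obtain ⟨T, hT, hTk⟩ := hinf.exists_subset_card_eq k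
  -- Keeping `x` to the right of every chosen gap that ends before gap `q` makes the intervals `[x,
  -- y]` nonoverlapping.
  have hpt : ∀ q ∈ T, ∃ x, (∀ p ∈ T, G.left p + G.width p < G.left q → G.left p + G.width p < x) ∧
      x < G.left q ∧ a ≤ x ∧ ∃ y ∈ G.gap q, m y + M y ≤ m x + M x - 1 / 4 := by
    intro q hq
    obtain ⟨⟨hq1, hq2⟩, hq3⟩ := hT hq
    have hev : ∀ᶠ x in 𝓝[<] (G.left q), (∀ p ∈ T, G.left p + G.width p < G.left q →
        G.left p + G.width p < x) ∧ x ∈ Ioo (max (x₀ - ε) (G.left q - G.width q)) (G.left q) := by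
      refine ((eventually_all_finset _).2 fun p _ => ?_).and
        (Ioo_mem_nhdsLT (max_lt hq1 (by linarith [G.width_pos q])))
      by_cases h : G.left p + G.width p < G.left q
      · filter_upwards [Ioo_mem_nhdsLT h] with x hx _ using hx.1
      · simp [h]
    obtain ⟨l, hl, hsub⟩ := mem_nhdsLT_iff_exists_Ioo_subset.1 hev
    obtain ⟨y, hy, hyq, hyl⟩ := G.left_approx q (_root_.sub_pos.2 hl)
    have hyl' : l < y := by linarith
    have hyI := (hsub ⟨hyl', hyq⟩).2
    have hycl := hcl y hy (by
      rw [abs_lt]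
      constructor <;> linarith [hyI.1, le_max_left (x₀ - ε) (G.left q - G.width q),
        G.width_pos q])
    -- The residue point just left of the gap is only a limit of good points, so it is replaced by a
    -- good one nearby.
    obtain ⟨x, hxI, hxE⟩ := mem_closure_iff.1 hycl (Ioo l (G.left q)) isOpen_Ioo ⟨hyl', hyq⟩
    obtain ⟨h1, h2⟩ := hsub hxI
    exact ⟨x, h1, hxI.2, hxE.1.1.1.1, G.exists_drop hxE.1 hxE.2 (hgap q) hxI.2
      ((le_max_right _ _).trans_lt h2.1) (not_le.1 hq3)⟩
  choose! x hxT hxl hxa y hy hdrop using hpt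
  let e : Fin k ≃ T := (finCongr hTk.symm).trans T.equivFin.symm
  have hsum := hanti.sum_sub_le hab.le (x := fun i => x (e i)) (y := fun i => y (e i))
    (fun i => ⟨hxa _ (e i).2, by linarith [hxl _ (e i).2, (hy _ (e i).2).1],
      by linarith [(hy _ (e i).2).2, G.right_lt (e i)]⟩)
    (fun i j hij => by
      have hne : ((e i : T) : ℚ) ≠ e j := fun h => hij (e.injective (Subtype.ext h))
      refine (G.right_lt_left_or _ _ hne).imp (fun h => ?_) fun h => ?_
      · linarith [(hy _ (e i).2).2, hxT _ (e j).2 _ (e i).2 h]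
      · linarith [(hy _ (e j).2).2, hxT _ (e i).2 _ (e j).2 h])
  have hlow : ∑ _i : Fin k, (1 / 4 : ℝ) ≤
      ∑ i, ((m (x (e i)) + M (x (e i))) - (m (y (e i)) + M (y (e i)))) :=
    Finset.sum_le_sum fun i _ => by linarith [hdrop _ (e i).2]
  simp only [Finset.sum_const, Finset.card_univ, Fintype.card_fin, nsmul_eq_mul] at hlow
  linarith

end GapFamily

end

theorem mainTheorem2 (a b : ℝ) (hab : a < b) (r : ℝ) (hr : 1 ≤ r) :
    ∃ f : ℝ → ℝ, HKIntegrable r a b f ∧ ∀ s : ℝ, 1 ≤ s → ¬ PerronIntegrable s a b f := by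
  obtain ⟨G⟩ := nonempty_gapFamily hab hr
  exact ⟨deriv G.bumpSum, G.hkIntegrable_deriv_bumpSum hr,
    fun s hs => G.not_perronIntegrable_deriv_bumpSum hr hs⟩
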